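/- All orders are linear and all groups are Abelian. Let $\mathcal L=(\leq,\mathbf 0,+,-)$ be the first-order language with a binary relation symbol, a constant, a binary function symbol and a unary function symbol. A *pre-dom* is an $\mathcal L$-structure $M$ such that $(M,\leq,\mathbf 0,+)$ is a linearly ordered Abelian monoid with neutral element $\mathbf 0$ (that is, $\leq$ is a linear order and $x\leq y$ implies $x+t\leq y+t$), and $-$ is order-reversing with $-(-x)=x$. Put $x+^R y:=-((-x)+(-y))$, $x-y:=x+^R(-y)$, $\delta:=-\mathbf 0$, $|x|:=\max(x,-x)$. A *dom* is a pre-dom satisfying, for all $x,y$: (MA) $\delta\leq\mathbf 0$; (MB) $|x|\geq\mathbf 0$; (MC) $x\geq y$ if and only if $x-y\geq\mathbf 0$. A dom is of the *first type* if $\delta=\mathbf 0$, of the *second type* if $\delta+\delta<\delta$, of the *third type* if $\delta+\delta=\delta<\mathbf 0$. A *sub-dom* is a substructure, i.e. a subset containing $\mathbf 0$ and closed under $+$ and $-$; below, "$M$ is a sub-dom of $N$" means that $M$ is isomorphic, as an $\mathcal L$-structure, to a sub-dom of $N$. For an ordered group $G$, a *cut* of $G$ is a partition $\Lambda=(\Lambda^L,\Lambda^R)$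 of $G$ into two (possibly empty) sets with every element of $\Lambda^L$ smaller than every element of $\Lambda^R$. Let $\check G$ be the set of cuts, with $\Lambda\leq\Gamma$ iff $\Lambda^L\subseteq\Gamma^L$, with $\Lambda+\Gamma$ the cut whose left part is $\{\lambda+\gamma:\lambda\in\Lambda^L,\gamma\in\Gamma^L\}$, with $-\Lambda=(-\Lambda^R,-\Lambda^L)$ and neutral element $0^+=((-\infty,0],(0,+\infty))$. Let $\tilde G$ be the disjoint union of $G$ and $\check G$, with neutral element $0\in G$, and with order, sum and minus extending those of $G$ and $\check G$ by: $\gamma<\Lambda$ iff $\gamma\in\Lambda^L$, $\Lambda<\gamma$ iff $\gamma\in\Lambda^R$, and $\gamma+\Lambda=\Lambda+\gamma=(\gamma+\Lambda^L,\gamma+\Lambda^R)$. An ordered group is *discretely ordered* if it has a least positive element, and *densely ordered* if between any two of its distinct elements there is a third one. A sentence is *universal* if it consists of universal quantifiers followed by a quantifier-free formula; the *universal part* of a theory is the set of its universal sentences; a set of axioms is said below to *be* the universal part of a theory if it consists of universal sentences and has the same consequences as that universal part, so that a universal sentence follows from the axioms if and only if it belongs to that theory. **Theorem 2.** 1. The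 theory of doms of the first type (axioms of doms, plus $\mathbf 0=\delta$) is the universal part of the theory of the structures $\tilde G$, as $G$ varies among ordered groups. Moreover, every dom of the first type is a sub-dom of $\tilde G$ for some ordered group $G$. 2. The theory of doms of the second type (axioms of pre-doms, (MA) with the strict inequality, (MB), (MC), and $\mathbf 0+^R\mathbf 0>\mathbf 0$) is the universal part of the theory of the structures $\check G$, as $G$ varies among discretely ordered groups. Moreover, every dom of the second type is a sub-dom of $\check G$ for some discretely ordered group $G$. 3. The theory of doms of the third type (axioms of pre-doms, (MA) with the strict inequality, (MB), (MC), and $\mathbf 0+^R\mathbf 0=\mathbf 0$) is the universal part of the theory of the structures $\check G$, as $G$ varies among densely ordered groups. Moreover, every dom of the third type is a sub-dom of $\check G$ for some densely ordered group $G$. -/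

import Mathlib

open FirstOrder

universe u

namespace DomCut

/-! ### The language `(≤, 0, +, -)` -/

/-- The function symbols: a constant `0`, a binary `+`, a unary `-`. -/
inductive DomFunc : ℕ → Type
  | zero : DomFunc 0
  | add : DomFunc 2
  | neg : DomFunc 1

/-- The only relation symbol: a binary `≤`. -/
inductive DomRel : ℕ → Type
  | le : DomRel 2

/-- The first-order language with signature `(≤, 0, +, -)`. -/
def domLang : FirstOrder.Language.{0, 0} where
  Functions := DomFunc
  Relations := DomRel

/-- Interpretation of the function symbols of `domLang`. -/
def interpFun {M : Type u} [Zero M] [Add M] [Neg M] :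
    ∀ {n : ℕ}, DomFunc n → (Fin n → M) → M
  | _, .zero, _ => 0
  | _, .add, x => x 0 + x 1
  | _, .neg, x => -(x 0)

/-- Interpretation of the relation symbol of `domLang`. -/
def interpRel {M : Type u} [LE M] : ∀ {n : ℕ}, DomRel n → (Fin n → M) → Prop
  | _, .le, x => x 0 ≤ x 1

/-- A type carrying `≤, 0, +, -` is a structure for the language `domLang`. -/
instance domStructure (M : Type u) [LE M] [Zero M] [Add M] [Neg M] : domLang.Structure M where
  funMap f x := interpFun (M := M) f x
  RelMap r x := interpRel (M := M) r x

/-! ### Pre-doms and doms -/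

section Doms

variable {M : Type u} [LE M] [Zero M] [Add M] [Neg M]

/-- The right sum `-((-x) + (-y))`. -/
def radd (x y : M) : M := -((-x) + (-y))

/-- The (right) difference: the right sum of `x` and `-y`. It equals `-((-x) + y)`
in a pre-dom. -/
def rsub (x y : M) : M := radd x (-y)

variable (M)

/-- The element `δ = -0`. -/
def delta : M := -(0 : M)

/-- A pre-dom: a linearly ordered Abelian monoid, with an order-reversing involution `-`. -/
structure IsPreDom : Prop where
  add_assoc : ∀ x y z : M, (x + y) + z = x + (y + z)
  add_comm : ∀ x y : M, x + y = y + x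
  add_zero : ∀ x : M, x + 0 = x
  le_refl : ∀ x : M, x ≤ x
  le_trans : ∀ x y z : M, x ≤ y → y ≤ z → x ≤ z
  le_antisymm : ∀ x y : M, x ≤ y → y ≤ x → x = y
  le_total : ∀ x y : M, x ≤ y ∨ y ≤ x
  add_le_add_right : ∀ x y t : M, x ≤ y → x + t ≤ y + t
  neg_le_neg : ∀ x y : M, x ≤ y → -y ≤ -x
  neg_neg : ∀ x : M, -(-x) = x

/-- A dom. The order being linear, `|x| = max x (-x) ≥ 0` says that `0 ≤ x` or `0 ≤ -x`. -/
structure IsDom : Prop extends IsPreDom M where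
  delta_le : delta M ≤ 0
  abs_nonneg : ∀ x : M, 0 ≤ x ∨ 0 ≤ -x
  le_iff : ∀ x y : M, y ≤ x ↔ 0 ≤ rsub x y

/-- First type: `δ = 0`. -/
def FirstType : Prop := delta M = 0

/-- Second type: `δ + δ < δ`. -/
def SecondType : Prop := delta M + delta M ≤ delta M ∧ ¬ delta M ≤ delta M + delta M

/-- Third type: `δ + δ = δ < 0`. -/
def ThirdType : Prop := delta M + delta M = delta M ∧ (delta M ≤ 0 ∧ ¬ 0 ≤ delta M)

end Doms

/-! ### The first-order axioms -/

section Axioms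

/-- Terms in the variables `0, …, n - 1`. -/
abbrev Tm (n : ℕ) : Type := domLang.Term (Empty ⊕ Fin n)

/-- Formulas in the variables `0, …, n - 1`. -/
abbrev Fm (n : ℕ) : Type := domLang.BoundedFormula Empty n

/-- The symbol `+` as an operation on terms. -/
def tadd {n : ℕ} (s t : Tm n) : Tm n := FirstOrder.Language.Functions.apply₂ (L := domLang) DomFunc.add s t

/-- The symbol `-` as an operation on terms. -/
def tneg {n : ℕ} (t : Tm n) : Tm n := FirstOrder.Language.Functions.apply₁ (L := domLang) DomFunc.neg t

/-- The symbol `0` as a term. -/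
def tzero {n : ℕ} : Tm n := FirstOrder.Language.Constants.term (L := domLang) DomFunc.zero

/-- The term for the right sum. -/
def tradd {n : ℕ} (s t : Tm n) : Tm n := tneg (tadd (tneg s) (tneg t))

/-- The term for the right difference. -/
def trsub {n : ℕ} (s t : Tm n) : Tm n := tradd s (tneg t)

/-- The term for `δ`. -/
def tdelta {n : ℕ} : Tm n := tneg tzero

/-- The formula `s ≤ t`. -/
def fle {n : ℕ} (s t : Tm n) : Fm n := FirstOrder.Language.Relations.boundedFormula₂ (L := domLang) DomRel.le s t

/-- The formula `s < t`. -/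
def flt {n : ℕ} (s t : Tm n) : Fm n := fle s t ⊓ ∼(fle t s)

/-- The `i`-th variable. -/
def v {n : ℕ} (i : Fin n) : Tm n := FirstOrder.Language.Term.var (Sum.inr i)

/-- The formula `s = t`. -/
def feq {n : ℕ} (s t : Tm n) : Fm n := FirstOrder.Language.Term.bdEqual s t

/-- The axioms of pre-doms. -/
def preDomTheory : domLang.Theory :=
  { ∀' ∀' ∀' (feq (n := 3) (tadd (tadd (v 0) (v 1)) (v 2)) (tadd (v 0) (tadd (v 1) (v 2)))),
    ∀' ∀' (feq (n := 2) (tadd (v 0) (v 1)) (tadd (v 1) (v 0))),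
    ∀' (feq (n := 1) (tadd (v 0) tzero) (v 0)),
    ∀' (fle (n := 1) (v 0) (v 0)),
    ∀' ∀' ∀' (fle (n := 3) (v 0) (v 1) ⟹ fle (v 1) (v 2) ⟹ fle (v 0) (v 2)),
    ∀' ∀' (fle (n := 2) (v 0) (v 1) ⟹ fle (v 1) (v 0) ⟹ feq (v 0) (v 1)),
    ∀' ∀' (fle (n := 2) (v 0) (v 1) ⊔ fle (v 1) (v 0)),
    ∀' ∀' ∀' (fle (n := 3) (v 0) (v 1) ⟹ fle (tadd (v 0) (v 2)) (tadd (v 1) (v 2))),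
    ∀' ∀' (fle (n := 2) (v 0) (v 1) ⟹ fle (tneg (v 1)) (tneg (v 0))),
    ∀' (feq (n := 1) (tneg (tneg (v 0))) (v 0)) }

/-- The axiom `δ ≤ 0`. -/
def axMA : domLang.Sentence := fle tdelta tzero

/-- The axiom `δ < 0`. -/
def axMAstrict : domLang.Sentence := flt tdelta tzero

/-- The axiom `|x| ≥ 0`. -/
def axMB : domLang.Sentence := ∀' (fle (n := 1) tzero (v 0) ⊔ fle tzero (tneg (v 0)))

/-- The axiom `x ≥ y ↔ x - y ≥ 0`. -/
def axMC : domLang.Sentence := ∀' ∀' (fle (n := 2) (v 1) (v 0) ⇔ fle tzero (trsub (v 0) (v 1)))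

/-- The axioms of doms. -/
def domTheory : domLang.Theory := preDomTheory ∪ {axMA, axMB, axMC}

/-- The theory of doms of the first type: the axioms of doms, and `0 = δ`. -/
def firstTheory : domLang.Theory := domTheory ∪ {feq tzero tdelta}

/-- The theory of doms of the second type: the axioms of doms with `δ < 0` in place of
`δ ≤ 0`, and `0 < 0 +ᴿ 0`. -/
def secondTheory : domLang.Theory :=
  preDomTheory ∪ {axMAstrict, axMB, axMC, flt tzero (tradd tzero tzero)}

/-- The theory of doms of the third type: the axioms of doms with `δ < 0` in place of
`δ ≤ 0`, and `0 +ᴿ 0 = 0`. -/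
def thirdTheory : domLang.Theory :=
  preDomTheory ∪ {axMAstrict, axMB, axMC, feq (tradd tzero tzero) tzero}

/-- The sentences that hold in all models of `T`. -/
def consequences (T : domLang.Theory) : domLang.Theory := {φ | T ⊨ᵇ φ}

/-- The universal sentences (universal quantifiers in front of a quantifier-free formula)
that belong to `T`. -/
def universalPart (T : domLang.Theory) : domLang.Theory := {φ | φ ∈ T ∧ φ.IsUniversal}

/-- `S` axiomatises the universal part of `T`: it consists of universal sentences, it has the
same consequences as the universal part of `T`, and the universal sentences that follow
from it are exactly those that belong to `T`. -/
def IsUniversalPart (S T : domLang.Theory) : Prop :=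
  S.IsUniversal ∧
  consequences S = consequences (universalPart T) ∧
  universalPart (consequences S) = universalPart T

end Axioms

/-! ### The models of these theories are the doms of the given type -/

section Models

variable {M : Type u} [LE M] [Zero M] [Add M] [Neg M]

@[simp] theorem realize_v {n : ℕ} (i : Fin n) (e : Empty → M) (xs : Fin n → M) :
    (v i).realize (Sum.elim e xs) = xs i := rfl

@[simp] theorem realize_tadd {n : ℕ} (s t : Tm n) (w : Empty ⊕ Fin n → M) :
    (tadd s t).realize w = s.realize w + t.realize w := rfl

@[simp] theorem realize_tneg {n : ℕ} (t : Tm n) (w : Empty ⊕ Fin n → M) :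
    (tneg t).realize w = -(t.realize w) := rfl

@[simp] theorem realize_tzero {n : ℕ} (w : Empty ⊕ Fin n → M) :
    (tzero : Tm n).realize w = 0 := rfl

@[simp] theorem realize_fle {n : ℕ} (s t : Tm n) (e : Empty → M) (xs : Fin n → M) :
    (fle s t).Realize e xs ↔
      s.realize (Sum.elim e xs) ≤ t.realize (Sum.elim e xs) := Iff.rfl

@[simp] theorem realize_feq {n : ℕ} (s t : Tm n) (e : Empty → M) (xs : Fin n → M) :
    (feq s t).Realize e xs ↔
      s.realize (Sum.elim e xs) = t.realize (Sum.elim e xs) := FirstOrder.Language.BoundedFormula.realize_bdEqual _ _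

theorem model_preDomTheory : M ⊨ preDomTheory ↔ IsPreDom M := by
  simp only [preDomTheory, FirstOrder.Language.Theory.model_iff, Set.mem_insert_iff, Set.mem_singleton_iff,
    forall_eq_or_imp, forall_eq, FirstOrder.Language.Sentence.Realize, FirstOrder.Language.Formula.Realize,
    FirstOrder.Language.BoundedFormula.realize_all, FirstOrder.Language.BoundedFormula.realize_imp,
    FirstOrder.Language.BoundedFormula.realize_sup, realize_fle, realize_feq, realize_tadd, realize_tneg,
    realize_tzero, realize_v]
  exact ⟨fun ⟨a, b, c, d, e, f, g, h, i, j⟩ => ⟨a, b, c, d, e, f, g, h, i, j⟩,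
    fun ⟨a, b, c, d, e, f, g, h, i, j⟩ => ⟨a, b, c, d, e, f, g, h, i, j⟩⟩

theorem realize_axMA : M ⊨ axMA ↔ delta M ≤ 0 := Iff.rfl

theorem realize_axMAstrict : M ⊨ axMAstrict ↔ delta M ≤ 0 ∧ ¬ 0 ≤ delta M := by
  simp only [axMAstrict, flt, FirstOrder.Language.Sentence.Realize, FirstOrder.Language.Formula.Realize,
    FirstOrder.Language.BoundedFormula.realize_inf, FirstOrder.Language.BoundedFormula.realize_not]
  exact Iff.rfl

theorem realize_axMB : M ⊨ axMB ↔ ∀ x : M, 0 ≤ x ∨ 0 ≤ -x := by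
  simp only [axMB, FirstOrder.Language.Sentence.Realize, FirstOrder.Language.Formula.Realize,
    FirstOrder.Language.BoundedFormula.realize_all, FirstOrder.Language.BoundedFormula.realize_sup]
  exact Iff.rfl

theorem realize_axMC : M ⊨ axMC ↔ ∀ x y : M, y ≤ x ↔ 0 ≤ rsub x y := by
  simp only [axMC, FirstOrder.Language.Sentence.Realize, FirstOrder.Language.Formula.Realize,
    FirstOrder.Language.BoundedFormula.realize_all, FirstOrder.Language.BoundedFormula.realize_iff]
  exact Iff.rfl

theorem model_domTheory : M ⊨ domTheory ↔ IsDom M := by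
  simp only [domTheory, FirstOrder.Language.Theory.model_union_iff, model_preDomTheory]
  simp only [FirstOrder.Language.Theory.model_iff, Set.mem_insert_iff, Set.mem_singleton_iff,
    forall_eq_or_imp, forall_eq, realize_axMA, realize_axMB, realize_axMC]
  exact ⟨fun ⟨a, b, c, d⟩ => ⟨a, b, c, d⟩, fun ⟨a, b, c, d⟩ => ⟨a, b, c, d⟩⟩

theorem model_firstTheory : M ⊨ firstTheory ↔ IsDom M ∧ FirstType M := by
  simp only [firstTheory, FirstOrder.Language.Theory.model_union_iff, model_domTheory]
  simp only [FirstOrder.Language.Theory.model_iff, Set.mem_singleton_iff, forall_eq,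
    FirstOrder.Language.Sentence.Realize, FirstOrder.Language.Formula.Realize, realize_feq]
  exact and_congr Iff.rfl eq_comm

theorem realize_zero_lt :
    M ⊨ (flt tzero (tradd tzero tzero) : domLang.Sentence) ↔
      (0 : M) ≤ radd 0 0 ∧ ¬ radd 0 0 ≤ (0 : M) := by
  simp only [flt, FirstOrder.Language.Sentence.Realize, FirstOrder.Language.Formula.Realize,
    FirstOrder.Language.BoundedFormula.realize_inf, FirstOrder.Language.BoundedFormula.realize_not]
  exact Iff.rfl

theorem realize_zero_eq :
    M ⊨ (feq (tradd tzero tzero) tzero : domLang.Sentence) ↔ radd 0 0 = (0 : M) := by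
  simp only [FirstOrder.Language.Sentence.Realize, FirstOrder.Language.Formula.Realize, realize_feq]
  exact Iff.rfl

theorem model_secondTheory : M ⊨ secondTheory ↔ IsDom M ∧ SecondType M := by
  simp only [secondTheory, FirstOrder.Language.Theory.model_union_iff, model_preDomTheory]
  simp only [FirstOrder.Language.Theory.model_iff, Set.mem_insert_iff, Set.mem_singleton_iff,
    forall_eq_or_imp, forall_eq, realize_axMAstrict, realize_axMB, realize_axMC, realize_zero_lt]
  constructor
  · rintro ⟨a, ⟨b, -⟩, c, d, e, f⟩
    refine ⟨⟨a, b, c, d⟩, ?_, fun h => f ?_⟩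
    · have := a.neg_le_neg _ _ e
      rwa [radd, a.neg_neg] at this
    · have := a.neg_le_neg _ _ h
      rwa [delta, a.neg_neg] at this
  · rintro ⟨⟨a, b, c, d⟩, e, f⟩
    refine ⟨a, ⟨b, fun h => f ?_⟩, c, d, ?_, fun h => f ?_⟩
    · have h0 : delta M = 0 := a.le_antisymm _ _ b h
      rw [h0, a.add_zero]
      exact a.le_refl 0
    · have := a.neg_le_neg _ _ e
      rwa [delta, a.neg_neg] at this
    · have := a.neg_le_neg _ _ h
      rwa [radd, a.neg_neg] at this

theorem model_thirdTheory : M ⊨ thirdTheory ↔ IsDom M ∧ ThirdType M := by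
  simp only [thirdTheory, FirstOrder.Language.Theory.model_union_iff, model_preDomTheory]
  simp only [FirstOrder.Language.Theory.model_iff, Set.mem_insert_iff, Set.mem_singleton_iff,
    forall_eq_or_imp, forall_eq, realize_axMAstrict, realize_axMB, realize_axMC, realize_zero_eq]
  constructor
  · rintro ⟨a, b, c, d, e⟩
    refine ⟨⟨a, b.1, c, d⟩, ?_, b⟩
    have := congrArg Neg.neg e
    rwa [radd, a.neg_neg] at this
  · rintro ⟨⟨a, _, c, d⟩, e, b⟩
    refine ⟨a, b, c, d, ?_⟩
    have := congrArg Neg.neg e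
    rwa [delta, a.neg_neg] at this

end Models

/-! ### Cuts of a linear order -/

/-- A cut: a partition of `O` into two (possibly empty) parts, with every element of the first
part smaller than every element of the second. -/
@[ext]
structure Cut (O : Type u) [LinearOrder O] where
  left : Set O
  right : Set O
  union_eq : left ∪ right = Set.univ
  lt : ∀ a ∈ left, ∀ b ∈ right, a < b

namespace Cut

section Order

variable {O : Type u} [LinearOrder O]

instance : LE (Cut O) := ⟨fun Λ Γ => Λ.left ⊆ Γ.left⟩

/-- The upper edge of `S`: the smallest cut whose left part contains `S`. -/
def upperEdge (S : Set O) : Cut O where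
  left := {x | ∃ s ∈ S, x ≤ s}
  right := {x | ∀ s ∈ S, s < x}
  union_eq := by
    ext x
    simp only [Set.mem_union, Set.mem_ofPred_eq, Set.mem_univ, iff_true]
    by_cases h : ∃ s ∈ S, x ≤ s
    · exact Or.inl h
    · push Not at h
      exact Or.inr h
  lt := by
    rintro a ⟨s, hs, has⟩ b hb
    exact lt_of_le_of_lt has (hb s hs)

end Order

section Group

variable {G : Type u} [AddCommGroup G] [LinearOrder G] [IsOrderedAddMonoid G]

/-- The neutral element `0⁺ = ((-∞, 0], (0, ∞))`. -/
instance : Zero (Cut G) := ⟨upperEdge {0}⟩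

/-- The (left) sum: the upper edge of the set of all sums `λ + γ`, with `λ`, `γ` in the
left parts. -/
instance : Add (Cut G) := ⟨fun Λ Γ => upperEdge {x | ∃ a ∈ Λ.left, ∃ b ∈ Γ.left, x = a + b}⟩

/-- `-Λ = (-Λᴿ, -Λᴸ)`. -/
instance : Neg (Cut G) := ⟨fun Λ =>
  { left := {x | -x ∈ Λ.right}
    right := {x | -x ∈ Λ.left}
    union_eq := by
      ext x
      have h : -x ∈ Λ.left ∪ Λ.right := by rw [Λ.union_eq]; trivial
      simpa [or_comm] using h
    lt := fun a ha b hb => neg_lt_neg_iff.mp (Λ.lt _ hb _ ha) }⟩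

/-- The translate `γ + Λ = (γ + Λᴸ, γ + Λᴿ)`. -/
def translate (g : G) (Λ : Cut G) : Cut G where
  left := {x | x - g ∈ Λ.left}
  right := {x | x - g ∈ Λ.right}
  union_eq := by
    ext x
    have h : x - g ∈ Λ.left ∪ Λ.right := by rw [Λ.union_eq]; trivial
    simpa using h
  lt := fun a ha b hb => by simpa using Λ.lt _ ha _ hb

end Group

end Cut

/-! ### The disjoint union of a group and its cuts -/

/-- The disjoint union of `G` and the set of cuts of `G`. -/
inductive Tilde (G : Type u) [LinearOrder G] : Type u
  | elt : G → Tilde G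
  | cut : Cut G → Tilde G

namespace Tilde

variable {G : Type u} [AddCommGroup G] [LinearOrder G] [IsOrderedAddMonoid G]

/-- For `γ` in `G` and a cut `Λ`, one has `γ < Λ` if `γ ∈ Λᴸ`, and `Λ < γ` if `γ ∈ Λᴿ`. -/
protected def le : Tilde G → Tilde G → Prop
  | elt a, elt b => a ≤ b
  | elt a, cut Λ => a ∈ Λ.left
  | cut Λ, elt a => a ∈ Λ.right
  | cut Λ, cut Γ => Λ ≤ Γ

/-- The sum extends the sums of `G` and of cuts; the mixed sums are translates. -/
protected def add : Tilde G → Tilde G → Tilde G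
  | elt a, elt b => elt (a + b)
  | elt a, cut Λ => cut (Λ.translate a)
  | cut Λ, elt a => cut (Λ.translate a)
  | cut Λ, cut Γ => cut (Λ + Γ)

/-- The minus extends those of `G` and of cuts. -/
protected def neg : Tilde G → Tilde G
  | elt a => elt (-a)
  | cut Λ => cut (-Λ)

instance : LE (Tilde G) := ⟨Tilde.le⟩
instance : Zero (Tilde G) := ⟨elt 0⟩
instance : Add (Tilde G) := ⟨Tilde.add⟩
instance : Neg (Tilde G) := ⟨Tilde.neg⟩

end Tilde

/-! ### The classes of structures -/

/-- A linearly ordered Abelian group is discretely ordered if it has a smallest positive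
element. -/
def DiscretelyOrdered (G : Type u) [AddCommGroup G] [LinearOrder G] : Prop :=
  ∃ g : G, IsLeast {x : G | 0 < x} g

/-- The theory of the structures `G̃`, for `G` an ordered Abelian group. -/
def tildeTheory : domLang.Theory :=
  {φ | ∀ (G : Type u) [AddCommGroup G] [LinearOrder G] [IsOrderedAddMonoid G], Tilde G ⊨ φ}

/-- The theory of the cuts of discretely ordered groups. -/
def discreteCutTheory : domLang.Theory :=
  {φ | ∀ (G : Type u) [AddCommGroup G] [LinearOrder G] [IsOrderedAddMonoid G],
    DiscretelyOrdered G → Cut G ⊨ φ}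

/-- The theory of the cuts of densely ordered groups. -/
def denseCutTheory : domLang.Theory :=
  {φ | ∀ (G : Type u) [AddCommGroup G] [LinearOrder G] [IsOrderedAddMonoid G],
    DenselyOrdered G → Cut G ⊨ φ}

end DomCut

set_option linter.unusedSectionVars false

namespace DomCut

/-! ### Cuts of ordered groups form doms -/

namespace Cut

section Order

variable {O : Type u} [LinearOrder O]

/-! The structures built from groups satisfy the axioms by direct computation, and universal
sentences pass to substructures, so everything reduces to embedding a dom `M` of given type in the
structure of a suitable group.

The width `-(x + -x)` of `x` is the largest `a` with `a + x ≤ x`. Widths are idempotent and a sum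
takes the larger width (`width_add`). The idempotents of `M` are the widths and some opposites of
widths (`idem_cases`). Absorption orders them linearly, and at each idempotent `i` there is a
maximal subgroup `Grp i`, an ordered group. An element of width strictly below `i` becomes
invertible after adding `i`, so it has a class in `Grp i`.

The wanted group must map onto all these subgroups, although the translations between them need not
be surjective. `Lift M` is therefore the group of units of `M` times a free Abelian group, with
countably many generators lifting each element of each subgroup at a nonzero idempotent. The
relation `Under f x` places `f` relative to `x`: if the generators of `f` have level at most the
width of `x`, the class of `f` at that width is compared with `x` in `M`; otherwise the comparison
takes place at a dominating generator, by class at its level and then by its coefficient. A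
generator thus sits infinitesimally above the element it lifts, and its opposite infinitesimally
below.

The group is ordered by position relative to `0`, and `x` is sent to the cut `{f | Under f x}`. Sums
are preserved by `Under.add` and its converse, the interpolation lemma `Under.split`; opposites by
`under_neg_iff`; and the order follows from these. The type of `M` decides the kind of group: if `δ`
is not idempotent, its inverse is the least positive element; if `δ` is a nonzero idempotent,
generators of level `δ` give arbitrarily small positive elements. If `δ = 0`, opposites of cuts go
wrong exactly at the elements of width zero; these are the units, and they are sent into the group
itself. -/

theorem mem_right_iff (Λ : Cut O) {x : O} : x ∈ Λ.right ↔ x ∉ Λ.left := by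
  constructor
  · exact fun hr hl => lt_irrefl _ (Λ.lt _ hl _ hr)
  · intro hl
    have h : x ∈ Λ.left ∪ Λ.right := by rw [Λ.union_eq]; trivial
    exact h.resolve_left hl

theorem mem_left_of_le (Λ : Cut O) {x y : O} (h : x ≤ y) (hy : y ∈ Λ.left) : x ∈ Λ.left := by
  by_contra hx
  exact absurd (Λ.lt _ hy _ (Λ.mem_right_iff.2 hx)) h.not_gt

theorem ext_left {Λ Γ : Cut O} (h : ∀ x, x ∈ Λ.left ↔ x ∈ Γ.left) : Λ = Γ := by
  refine Cut.ext (Set.ext h) (Set.ext fun x => ?_)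
  rw [mem_right_iff, mem_right_iff, h]

theorem le_def {Λ Γ : Cut O} : Λ ≤ Γ ↔ ∀ x, x ∈ Λ.left → x ∈ Γ.left := Iff.rfl

theorem le_antisymm' {Λ Γ : Cut O} (h : Λ ≤ Γ) (h' : Γ ≤ Λ) : Λ = Γ :=
  ext_left fun _ => ⟨fun hx => h hx, fun hx => h' hx⟩

theorem le_total' (Λ Γ : Cut O) : Λ ≤ Γ ∨ Γ ≤ Λ := by
  by_contra! h
  obtain ⟨h₁, h₂⟩ := h
  obtain ⟨x, hx, hx'⟩ := Set.not_subset.1 h₁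
  obtain ⟨y, hy, hy'⟩ := Set.not_subset.1 h₂
  rcases le_total x y with h | h
  · exact hx' (Γ.mem_left_of_le h hy)
  · exact hy' (Λ.mem_left_of_le h hx)

end Order

section Group

variable {G : Type u} [AddCommGroup G] [LinearOrder G] [IsOrderedAddMonoid G]

theorem mem_zero {x : G} : x ∈ (0 : Cut G).left ↔ x ≤ 0 := by
  change (∃ s ∈ ({0} : Set G), x ≤ s) ↔ _
  simp

theorem mem_add {Λ Γ : Cut G} {x : G} :
    x ∈ (Λ + Γ).left ↔ ∃ a ∈ Λ.left, x - a ∈ Γ.left := by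
  change (∃ s ∈ {y | ∃ a ∈ Λ.left, ∃ b ∈ Γ.left, y = a + b}, x ≤ s) ↔ _
  constructor
  · rintro ⟨_, ⟨a, ha, b, hb, rfl⟩, hx⟩
    exact ⟨a, ha, Γ.mem_left_of_le (by rwa [sub_le_iff_le_add']) hb⟩
  · rintro ⟨a, ha, hb⟩
    exact ⟨x, ⟨a, ha, x - a, hb, by simp⟩, le_rfl⟩

theorem mem_neg {Λ : Cut G} {x : G} : x ∈ (-Λ).left ↔ -x ∉ Λ.left :=
  Λ.mem_right_iff

theorem mem_translate {g : G} {Λ : Cut G} {x : G} : x ∈ (Λ.translate g).left ↔ x - g ∈ Λ.left :=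
  Iff.rfl

theorem mem_delta {x : G} : x ∈ (delta (Cut G)).left ↔ x < 0 := by
  rw [delta, mem_neg, mem_zero, not_le, neg_pos]

protected theorem add_assoc (Λ Γ Δ : Cut G) : Λ + Γ + Δ = Λ + (Γ + Δ) := by
  refine ext_left fun x => ?_
  simp only [mem_add]
  constructor
  · rintro ⟨a, ⟨b, hb, hc⟩, hd⟩
    exact ⟨b, hb, a - b, hc, by simpa using hd⟩
  · rintro ⟨b, hb, c, hc, hd⟩
    exact ⟨b + c, ⟨b, hb, by simpa using hc⟩, by simpa [sub_sub] using hd⟩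

protected theorem add_comm (Λ Γ : Cut G) : Λ + Γ = Γ + Λ := by
  refine ext_left fun x => ?_
  simp only [mem_add]
  constructor <;>
  · rintro ⟨a, ha, hb⟩
    exact ⟨x - a, hb, by simpa using ha⟩

protected theorem add_zero (Λ : Cut G) : Λ + 0 = Λ := by
  refine ext_left fun x => ?_
  simp only [mem_add, mem_zero, sub_nonpos]
  exact ⟨fun ⟨a, ha, h⟩ => Λ.mem_left_of_le h ha, fun h => ⟨x, h, le_rfl⟩⟩

protected theorem add_le_add_right {Λ Γ : Cut G} (h : Λ ≤ Γ) (Δ : Cut G) : Λ + Δ ≤ Γ + Δ := by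
  intro x
  simp only [mem_add]
  exact fun ⟨a, ha, hb⟩ => ⟨a, h ha, hb⟩

protected theorem neg_le_neg {Λ Γ : Cut G} (h : Λ ≤ Γ) : -Γ ≤ -Λ := by
  intro x
  simp only [mem_neg]
  exact fun hx hx' => hx (h hx')

protected theorem neg_neg (Λ : Cut G) : - -Λ = Λ :=
  ext_left fun x => by simp [mem_neg]

theorem zero_le_iff {Λ : Cut G} : 0 ≤ Λ ↔ (0 : G) ∈ Λ.left :=
  ⟨fun h => h (mem_zero.2 le_rfl), fun h _ hx => Λ.mem_left_of_le (mem_zero.1 hx) h⟩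

/-- Unfolding the difference, `0` fails to lie in its left part exactly when some element of
`Γ.left` is outside `Λ.left`. -/
theorem zero_mem_rsub_iff {Λ Γ : Cut G} : (0 : G) ∈ (rsub Λ Γ).left ↔ Γ ≤ Λ := by
  simp only [rsub, radd, Cut.neg_neg, mem_neg, mem_add, neg_zero, not_exists, not_and, zero_sub]
  refine ⟨fun h x hx => ?_, fun h x hx hx' => hx (h hx')⟩
  by_contra hx'
  exact h (-x) (by simpa using hx') (by simpa using hx)

theorem isDom (G : Type u) [AddCommGroup G] [LinearOrder G] [IsOrderedAddMonoid G] :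
    IsDom (Cut G) where
  add_assoc := Cut.add_assoc
  add_comm := Cut.add_comm
  add_zero := Cut.add_zero
  le_refl _ _ h := h
  le_trans _ _ _ h h' _ hx := h' (h hx)
  le_antisymm _ _ := le_antisymm'
  le_total := le_total'
  add_le_add_right _ _ t h := Cut.add_le_add_right h t
  neg_le_neg _ _ := Cut.neg_le_neg
  neg_neg := Cut.neg_neg
  delta_le x := by
    rw [mem_delta, mem_zero]
    exact le_of_lt
  abs_nonneg Λ := by
    rw [zero_le_iff, zero_le_iff, mem_neg, neg_zero]
    exact em _
  le_iff Λ Γ := by rw [zero_le_iff, zero_mem_rsub_iff]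

/-- Here `δ` is the cut of the negative elements. If `g` is the least positive element, `-g` lies
below `δ` but is not bounded by a sum of two negative elements. -/
theorem secondType (hG : DiscretelyOrdered G) : SecondType (Cut G) := by
  obtain ⟨g, hg, hmin⟩ := hG
  have hg : 0 < g := hg
  have hle : ∀ x : G, x < 0 → x ≤ -g := fun x hx => by
    have : g ≤ -x := hmin (show 0 < -x by simpa using hx)
    exact le_neg_of_le_neg this
  refine ⟨fun x => ?_, fun h => ?_⟩
  · simp only [mem_add, mem_delta]
    rintro ⟨a, ha, hb⟩
    exact (sub_neg.1 hb).trans ha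
  · have := h (mem_delta.2 (neg_lt_zero.2 hg))
    simp only [mem_add, mem_delta] at this
    obtain ⟨a, ha, hb⟩ := this
    exact absurd (sub_neg.1 hb) (hle a ha).not_gt

theorem thirdType (hG : DenselyOrdered G) : ThirdType (Cut G) := by
  refine ⟨ext_left fun x => ?_, (isDom G).delta_le, fun h => ?_⟩
  · simp only [mem_add, mem_delta]
    constructor
    · rintro ⟨a, ha, hb⟩
      exact (sub_neg.1 hb).trans ha
    · intro hx
      obtain ⟨a, ha, hb⟩ := exists_between hx
      exact ⟨a, hb, sub_neg.2 ha⟩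
  · rw [zero_le_iff, mem_delta] at h
    exact lt_irrefl _ h

theorem translate_add (g : G) (Λ Γ : Cut G) : Λ.translate g + Γ = (Λ + Γ).translate g := by
  refine ext_left fun x => ?_
  simp only [mem_add, mem_translate]
  constructor
  · rintro ⟨a, ha, hb⟩
    exact ⟨a - g, ha, by simpa using hb⟩
  · rintro ⟨a, ha, hb⟩
    exact ⟨a + g, by simpa using ha, by simpa [sub_sub, add_comm] using hb⟩

theorem translate_translate (g h : G) (Λ : Cut G) :
    (Λ.translate g).translate h = Λ.translate (g + h) :=
  ext_left fun x => by simp only [mem_translate, sub_sub, add_comm h g]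

theorem add_translate (g : G) (Λ Γ : Cut G) : Λ + Γ.translate g = (Λ + Γ).translate g := by
  rw [Cut.add_comm, translate_add, Cut.add_comm]

theorem translate_zero (Λ : Cut G) : Λ.translate 0 = Λ :=
  ext_left fun x => by simp only [mem_translate, sub_zero]

end Group

end Cut

/-! ### The disjoint union of a group and its cuts is a dom -/

namespace Tilde

variable {G : Type u} [AddCommGroup G] [LinearOrder G] [IsOrderedAddMonoid G]

@[simp] theorem elt_le_elt {a b : G} : (elt a : Tilde G) ≤ elt b ↔ a ≤ b := Iff.rfl
@[simp] theorem elt_le_cut {a : G} {Λ : Cut G} : elt a ≤ cut Λ ↔ a ∈ Λ.left := Iff.rfl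
@[simp] theorem cut_le_elt {a : G} {Λ : Cut G} : cut Λ ≤ elt a ↔ a ∉ Λ.left := Λ.mem_right_iff
@[simp] theorem cut_le_cut {Λ Γ : Cut G} : cut Λ ≤ cut Γ ↔ ∀ x ∈ Λ.left, x ∈ Γ.left := Iff.rfl
@[simp] theorem elt_add_elt (a b : G) : (elt a + elt b : Tilde G) = elt (a + b) := rfl
@[simp] theorem elt_add_cut (a : G) (Λ : Cut G) : elt a + cut Λ = cut (Λ.translate a) := rfl
@[simp] theorem cut_add_elt (a : G) (Λ : Cut G) : cut Λ + elt a = cut (Λ.translate a) := rfl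
@[simp] theorem cut_add_cut (Λ Γ : Cut G) : cut Λ + cut Γ = cut (Λ + Γ) := rfl
@[simp] theorem neg_elt (a : G) : -(elt a : Tilde G) = elt (-a) := rfl
@[simp] theorem neg_cut (Λ : Cut G) : -cut Λ = cut (-Λ) := rfl
theorem zero_def : (0 : Tilde G) = elt 0 := rfl

theorem firstType : FirstType (Tilde G) := by
  simp [FirstType, delta, zero_def]

theorem isDom (G : Type u) [AddCommGroup G] [LinearOrder G] [IsOrderedAddMonoid G] :
    IsDom (Tilde G) where
  add_assoc x y z := by
    cases x <;> cases y <;> cases z <;>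
      simp [Cut.translate_add, Cut.add_translate, Cut.translate_translate, Cut.add_assoc,
        add_comm, add_left_comm]
  add_comm x y := by
    cases x <;> cases y <;> simp [Cut.add_comm, add_comm]
  add_zero x := by cases x <;> simp [zero_def, Cut.translate_zero]
  le_refl x := by cases x <;> simp
  le_trans x y z := by
    cases x <;> cases y <;> cases z <;> simp only [elt_le_elt, elt_le_cut, cut_le_elt, cut_le_cut]
    · exact le_trans
    · exact fun h h' => Cut.mem_left_of_le _ h h'
    · exact fun h h' => le_of_not_ge fun h'' => h' (Cut.mem_left_of_le _ h'' h)
    · exact fun h h' => h' _ h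
    · exact fun h h' h'' => h (Cut.mem_left_of_le _ h' h'')
    · rename_i Λ a Γ
      exact fun h h' x hx => Cut.mem_left_of_le _ (le_of_not_ge fun h'' => h (Cut.mem_left_of_le _ h'' hx)) h'
    · exact fun h h' h'' => h' (h _ h'')
    · exact fun h h' x hx => h' x (h x hx)
  le_antisymm x y := by
    cases x <;> cases y <;> simp only [elt_le_elt, elt_le_cut, cut_le_elt, cut_le_cut]
    · exact fun h h' => by rw [le_antisymm h h']
    · exact fun h h' => absurd h h'
    · exact fun h h' => absurd h' h
    · exact fun h h' => by rw [Cut.le_antisymm' h h']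
  le_total x y := by
    cases x <;> cases y <;> simp only [elt_le_elt, elt_le_cut, cut_le_elt, cut_le_cut]
    · exact le_total _ _
    · exact em _
    · exact (em _).symm
    · exact Cut.le_total' _ _
  add_le_add_right x y t := by
    cases x <;> cases y <;> cases t <;>
      simp only [elt_le_elt, elt_le_cut, cut_le_elt, cut_le_cut, elt_add_elt, elt_add_cut,
        cut_add_elt, cut_add_cut, Cut.mem_translate, Cut.mem_add, add_sub_cancel_right]
    · exact fun h => add_le_add_left h _
    · exact fun h x hx => Cut.mem_left_of_le _ (sub_le_sub_left h x) hx
    · exact id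
    · exact fun h x hx => ⟨_, h, hx⟩
    · exact id
    · rintro h x ⟨a, ha, hb⟩
      exact Cut.mem_left_of_le _
        (sub_le_sub_left (le_of_not_ge fun h' => h (Cut.mem_left_of_le _ h' ha)) x) hb
    · exact fun h x hx => h _ hx
    · exact fun h x ⟨a, ha, hb⟩ => ⟨a, h _ ha, hb⟩
  neg_le_neg x y := by
    cases x <;> cases y <;>
      simp only [elt_le_elt, elt_le_cut, cut_le_elt, cut_le_cut, neg_elt, neg_cut, Cut.mem_neg,
        neg_neg, not_not, neg_le_neg_iff, imp_self]
    exact fun h x hx hx' => hx (h _ hx')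
  neg_neg x := by cases x <;> simp [Cut.neg_neg]
  delta_le := by simp [delta, zero_def]
  abs_nonneg x := by
    cases x <;> simp only [zero_def, elt_le_elt, elt_le_cut, neg_elt, neg_cut, Cut.mem_neg,
      neg_nonneg, neg_zero]
    · exact le_total _ _
    · exact em _
  le_iff x y := by
    cases x <;> cases y
    · simp [rsub, radd, zero_def]
    · simp [rsub, radd, zero_def, Cut.mem_translate, Cut.mem_neg]
    · simp [rsub, radd, zero_def, Cut.mem_translate, Cut.mem_neg]
    · rw [cut_le_cut, ← Cut.le_def, ← Cut.zero_mem_rsub_iff]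
      exact Iff.rfl

end Tilde

/-! ### Universality of the axioms -/

section Universal

open FirstOrder.Language FirstOrder.Language.BoundedFormula

variable {n : ℕ}

theorem fle_isQF (s t : Tm n) : (fle s t).IsQF := (IsAtomic.rel _ _).isQF

theorem feq_isQF (s t : Tm n) : (feq s t).IsQF := (IsAtomic.equal _ _).isQF

theorem flt_isQF (s t : Tm n) : (flt s t).IsQF := (fle_isQF s t).inf (fle_isQF t s).not

theorem preDomTheory_isUniversal : preDomTheory.IsUniversal := by
  constructor
  intro φ hφ
  simp only [preDomTheory, Set.mem_insert_iff, Set.mem_singleton_iff] at hφ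
  rcases hφ with rfl | rfl | rfl | rfl | rfl | rfl | rfl | rfl | rfl | rfl
  · exact (feq_isQF _ _).isUniversal.all.all.all
  · exact (feq_isQF _ _).isUniversal.all.all
  · exact (feq_isQF _ _).isUniversal.all
  · exact (fle_isQF _ _).isUniversal.all
  · exact ((fle_isQF _ _).imp ((fle_isQF _ _).imp (fle_isQF _ _))).isUniversal.all.all.all
  · exact ((fle_isQF _ _).imp ((fle_isQF _ _).imp (feq_isQF _ _))).isUniversal.all.all
  · exact ((fle_isQF _ _).sup (fle_isQF _ _)).isUniversal.all.all
  · exact ((fle_isQF _ _).imp (fle_isQF _ _)).isUniversal.all.all.all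
  · exact ((fle_isQF _ _).imp (fle_isQF _ _)).isUniversal.all.all
  · exact (feq_isQF _ _).isUniversal.all

theorem axMA_isUniversal : axMA.IsUniversal := (fle_isQF _ _).isUniversal

theorem axMAstrict_isUniversal : axMAstrict.IsUniversal := (flt_isQF _ _).isUniversal

theorem axMB_isUniversal : axMB.IsUniversal :=
  ((fle_isQF _ _).sup (fle_isQF _ _)).isUniversal.all

theorem axMC_isUniversal : axMC.IsUniversal :=
  (((fle_isQF _ _).imp (fle_isQF _ _)).inf ((fle_isQF _ _).imp (fle_isQF _ _))).isUniversal.all.all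

theorem firstTheory_isUniversal : firstTheory.IsUniversal := by
  constructor
  rintro φ ((hφ | rfl | rfl | rfl) | rfl)
  · exact preDomTheory_isUniversal.isUniversal_of_mem hφ
  · exact axMA_isUniversal
  · exact axMB_isUniversal
  · exact axMC_isUniversal
  · exact (feq_isQF _ _).isUniversal

theorem secondTheory_isUniversal : secondTheory.IsUniversal := by
  constructor
  rintro φ (hφ | rfl | rfl | rfl | rfl)
  · exact preDomTheory_isUniversal.isUniversal_of_mem hφ
  · exact axMAstrict_isUniversal
  · exact axMB_isUniversal
  · exact axMC_isUniversal
  · exact (flt_isQF _ _).isUniversal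

theorem thirdTheory_isUniversal : thirdTheory.IsUniversal := by
  constructor
  rintro φ (hφ | rfl | rfl | rfl | rfl)
  · exact preDomTheory_isUniversal.isUniversal_of_mem hφ
  · exact axMAstrict_isUniversal
  · exact axMB_isUniversal
  · exact axMC_isUniversal
  · exact (feq_isQF _ _).isUniversal

/-- A universal set of sentences axiomatises the universal part of `T` as soon as its universal
consequences are the universal sentences of `T`. -/
theorem isUniversalPart_of_universal_iff {S T : domLang.Theory} (hS : S.IsUniversal)
    (h : ∀ φ : domLang.Sentence, φ.IsUniversal → (S ⊨ᵇ φ ↔ φ ∈ T)) : IsUniversalPart S T := by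
  have hu : universalPart (consequences S) = universalPart T := by
    ext φ
    exact and_congr_left fun hφ => h φ hφ
  refine ⟨hS, Set.Subset.antisymm (fun φ hφ => ?_) (fun φ hφ => ?_), hu⟩
  · rw [consequences, Set.mem_ofPred_eq, Theory.models_sentence_iff] at hφ ⊢
    intro N
    have : N ⊨ S := ⟨fun ψ hψ => Theory.realize_sentence_of_mem (universalPart T)
      ⟨(h ψ (hS.isUniversal_of_mem hψ)).1 (Theory.models_sentence_of_mem hψ),
        hS.isUniversal_of_mem hψ⟩⟩
    exact hφ (Theory.ModelType.of S N)
  · rw [consequences, Set.mem_ofPred_eq, Theory.models_sentence_iff] at hφ ⊢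
    intro N
    have : N ⊨ universalPart T := ⟨fun ψ hψ =>
      Theory.ModelsBoundedFormula.realize_sentence ((h ψ hψ.2).2 hψ.1) N⟩
    exact hφ (Theory.ModelType.of (universalPart T) N)

theorem realize_of_embedding {M N : Type*} [domLang.Structure M] [domLang.Structure N]
    (f : M ↪[domLang] N) {φ : domLang.Sentence} (hφ : φ.IsUniversal) (h : N ⊨ φ) : M ⊨ φ := by
  refine hφ.realize_embedding f ?_
  rw [Subsingleton.elim (f ∘ default) default, Subsingleton.elim (f ∘ default) default]
  exact h

end Universal

/-! ### Changing the universe of a model -/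

section Lift

variable (N : Type*) [domLang.Structure N]

/-- The order of a structure for `domLang`, in another universe. -/
abbrev liftLE : LE (ULift.{u} N) :=
  ⟨fun x y => FirstOrder.Language.Structure.RelMap (L := domLang) DomRel.le ![x.down, y.down]⟩

/-- The neutral element of a structure for `domLang`, in another universe. -/
abbrev liftZero : Zero (ULift.{u} N) :=
  ⟨⟨FirstOrder.Language.Structure.funMap (L := domLang) DomFunc.zero ![]⟩⟩

/-- The sum of a structure for `domLang`, in another universe. -/
abbrev liftAdd : Add (ULift.{u} N) :=
  ⟨fun x y => ⟨FirstOrder.Language.Structure.funMap (L := domLang) DomFunc.add ![x.down, y.down]⟩⟩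

/-- The minus of a structure for `domLang`, in another universe. -/
abbrev liftNeg : Neg (ULift.{u} N) :=
  ⟨fun x => ⟨FirstOrder.Language.Structure.funMap (L := domLang) DomFunc.neg ![x.down]⟩⟩

/-- A structure for `domLang` is isomorphic to its lift to another universe. -/
def liftEquiv :
    letI := liftLE.{u} N
    letI := liftZero.{u} N
    letI := liftAdd.{u} N
    letI := liftNeg.{u} N
    N ≃[domLang] ULift.{u} N :=
  letI := liftLE.{u} N
  letI := liftZero.{u} N
  letI := liftAdd.{u} N
  letI := liftNeg.{u} N
  { Equiv.ulift.symm with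
    map_fun' := by
      intro n f x
      cases f
      · exact congrArg ULift.up (congrArg _ (Subsingleton.elim x ![]))
      · exact congrArg ULift.up (congrArg _ (List.ofFn_inj.1 rfl : x = ![x 0, x 1]))
      · exact congrArg ULift.up (congrArg _ (List.ofFn_inj.1 rfl : x = ![x 0]))
    map_rel' := by
      intro n r x
      cases r
      exact Eq.to_iff (congrArg _ (List.ofFn_inj.1 rfl : ![x 0, x 1] = x)) }

end Lift

/-- If each model of `S` embeds in a structure in which the universal sentence `φ` holds, then
`φ` is a consequence of `S`; here it is enough to look at the models in one universe. -/
theorem models_of_forall_embedding {S : domLang.Theory} {φ : domLang.Sentence}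
    (hφ : φ.IsUniversal)
    (h : ∀ (M : Type u) [LE M] [Zero M] [Add M] [Neg M], M ⊨ S →
      ∃ (N : Type u) (_ : domLang.Structure N), N ⊨ φ ∧ Nonempty (M ↪[domLang] N)) :
    S ⊨ᵇ φ := by
  rw [FirstOrder.Language.Theory.models_sentence_iff]
  intro N
  let _ := liftLE.{u} N
  let _ := liftZero.{u} N
  let _ := liftAdd.{u} N
  let _ := liftNeg.{u} N
  have e : N ≃[domLang] ULift.{u} N := liftEquiv N
  obtain ⟨K, _, hK, ⟨f⟩⟩ := h (ULift.{u} N) (FirstOrder.Language.StrongHomClass.theory_model e)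
  exact realize_of_embedding (f.comp e.toEmbedding) hφ hK

/-! ### Arithmetic of doms -/

/-- Doms as a class. The condition `y ≤ x ↔ 0 ≤ x - y` is stated as the
equivalent residuation property. -/
class Dom (M : Type u) extends AddCommMonoid M, LinearOrder M, IsOrderedAddMonoid M,
    InvolutiveNeg M where
  le_neg_iff' : ∀ a b : M, a ≤ -b ↔ a + b ≤ -0
  nonneg_or' : ∀ a : M, 0 ≤ a ∨ a ≤ -0
  neg_zero_le' : (-0 : M) ≤ 0

namespace Dom

variable {M : Type u} [Dom M] {x y z a b u v : M}

theorem le_neg_iff : a ≤ -b ↔ a + b ≤ -0 := le_neg_iff' a b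

theorem nonneg_or (a : M) : 0 ≤ a ∨ a ≤ -0 := nonneg_or' a

theorem neg_zero_le : (-0 : M) ≤ 0 := neg_zero_le'

/-- Residuation: adding `y` has the right adjoint `z ↦ -(y + -z)`. The arithmetic of widths rests on
this. -/
theorem add_le_iff : x + y ≤ z ↔ x ≤ -(y + -z) := by
  rw [le_neg_iff, ← add_assoc, ← le_neg_iff, neg_neg]

theorem neg_le_neg' (h : a ≤ b) : -b ≤ -a := by
  rw [le_neg_iff]
  calc -b + a ≤ -b + b := by gcongr
    _ ≤ -0 := le_neg_iff.1 le_rfl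

theorem neg_le_iff : -a ≤ b ↔ -b ≤ a :=
  ⟨fun h => by simpa using neg_le_neg' h, fun h => by simpa using neg_le_neg' h⟩

theorem le_neg_comm : a ≤ -b ↔ b ≤ -a :=
  ⟨fun h => by simpa using neg_le_neg' h, fun h => by simpa using neg_le_neg' h⟩

/-- The width of an element. -/
def width (x : M) : M := -(x + -x)

theorem add_neg_eq (x : M) : x + -x = -width x := (neg_neg _).symm

theorem le_width_iff : a ≤ width x ↔ a + x ≤ x := add_le_iff.symm

theorem width_nonneg (x : M) : 0 ≤ width x := le_width_iff.2 (by rw [zero_add])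

theorem width_add_self (x : M) : width x + x = x :=
  le_antisymm (le_width_iff.1 le_rfl) (le_add_of_nonneg_left (width_nonneg x))

theorem add_width_self (x : M) : x + width x = x := by rw [add_comm, width_add_self]

theorem width_neg (x : M) : width (-x) = width x := by
  rw [width, width, neg_neg, add_comm]

theorem width_eq_of_idem (h0 : 0 ≤ u) (hu : u + u = u) : width u = u := by
  refine le_antisymm ?_ (le_width_iff.2 hu.le)
  calc width u ≤ width u + u := le_add_of_nonneg_right h0
    _ ≤ u := le_width_iff.1 le_rfl

theorem width_idem (x : M) : width x + width x = width x := by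
  refine le_antisymm ?_ (le_add_of_nonneg_left (width_nonneg x))
  rw [le_width_iff, add_assoc, width_add_self, width_add_self]

theorem width_width (x : M) : width (width x) = width x :=
  width_eq_of_idem (width_nonneg x) (width_idem x)

theorem width_zero : width (0 : M) = 0 := width_eq_of_idem le_rfl (add_zero 0)

theorem neg_width_nonpos (x : M) : -width x ≤ 0 :=
  (neg_le_neg' (width_nonneg x)).trans neg_zero_le

/-- Elements between `0` and the width of `x` are absorbed by `x`. -/
theorem add_eq_of_le_width (h0 : 0 ≤ a) (h : a ≤ width x) : a + x = x :=
  le_antisymm (le_width_iff.1 h) (le_add_of_nonneg_left h0)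

theorem add_neg_width (x : M) : width x + -width x = -width x := by
  have := width_add_self (-width x)
  rwa [width_neg, width_width] at this

/-- `v + -u = v` for widths `u < v`. -/
theorem add_neg_of_lt (h : width x < width y) : width y + -width x = width y := by
  refine le_antisymm (add_le_of_nonpos_right (neg_width_nonpos x)) ?_
  have h0 : 0 ≤ width y + -width x := by
    refine (nonneg_or _).resolve_right fun h' => ?_
    rw [← le_neg_iff, neg_neg] at h'
    exact h'.not_gt h
  calc width y ≤ width y + (width y + -width x) := le_add_of_nonneg_right h0
    _ = width y + -width x := by rw [← add_assoc, width_idem]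

/-- `y` absorbs its own width, which in turn swallows `-width x`. -/
theorem neg_width_add_of_lt (h : width x < width y) : -width x + y = y := by
  calc -width x + y = (width y + -width x) + y := by
        rw [add_comm (width y), add_assoc, width_add_self]
    _ = y := by rw [add_neg_of_lt h, width_add_self]

/-- If `-w` is not idempotent, where `w` is the width of `x`, then `-w` is invertible in the
monoid of elements of width `w`. -/
theorem neg_width_add_inv (h : -width x + -width x ≠ -width x) :
    -width x + -(-width x + -width x) = width x := by
  set w := width x with hw
  have hle : -w + -w ≤ -w := add_le_of_nonpos_left (neg_width_nonpos x)
  have h0 : 0 ≤ -w + -(-w + -w) := by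
    refine (nonneg_or _).resolve_right fun h' => h (le_antisymm hle ?_)
    rwa [← le_neg_iff, neg_neg] at h'
  apply le_antisymm
  · rw [add_comm, add_le_iff]
  · calc w ≤ w + (-w + -(-w + -w)) := le_add_of_nonneg_right h0
      _ = -w + -(-w + -w) := by rw [← add_assoc, add_neg_width]

/-- The width `z` of `x + y` fixes `x + y`, hence also `-width x + -width y`. Removing the first
summand shows that `z` fixes `-width y`, whose width is `width y`. The removal is absorption if the
widths differ; if they agree, `-width y` is either idempotent or invertible. -/
theorem width_add_le (h : width x ≤ width y) : width (x + y) ≤ width y := by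
  set z := width (x + y) with hz
  have h1 : z + (x + y) = x + y := width_add_self _
  have h2 : z + (-width x + -width y) = -width x + -width y := by
    rw [← add_neg_eq, ← add_neg_eq]
    calc z + (x + -x + (y + -y)) = z + (x + y) + (-x + -y) := by ac_rfl
      _ = x + -x + (y + -y) := by rw [h1]; ac_rfl
  have h3 : z + -width y = -width y := by
    rcases h.lt_or_eq with h | h
    · have : -width x + -width y = -width y := by
        have := neg_width_add_of_lt (x := x) (y := -width y) (by rwa [width_neg, width_width])
        exact this
      rwa [this] at h2
    · rw [h] at h2
      by_cases hi : -width y + -width y = -width y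
      · rwa [hi] at h2
      · have hp := neg_width_add_inv hi
        set p := -(-width y + -width y)
        calc z + -width y = z + (-width y + width y) := by
              rw [add_comm (-width y), add_neg_width]
          _ = z + (-width y + (-width y + p)) := by rw [hp]
          _ = z + (-width y + -width y) + p := by ac_rfl
          _ = -width y + (-width y + p) := by rw [h2]; ac_rfl
          _ = -width y := by rw [hp, add_comm, add_neg_width]
  have := le_width_iff.2 h3.le
  rwa [width_neg, width_width] at this

theorem le_width_add : width y ≤ width (x + y) := by
  rw [le_width_iff, add_left_comm, width_add_self]

theorem width_add (h : width x ≤ width y) : width (x + y) = width y :=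
  le_antisymm (width_add_le h) le_width_add

/-- The idempotents are the widths and some opposites of widths. -/
theorem idem_cases (h : a + a = a) : a = width a ∨ a = -width a := by
  rcases nonneg_or a with h0 | h0
  · exact Or.inl (width_eq_of_idem h0 h).symm
  right
  set w := width a with hw
  have ha0 : a ≤ 0 := h0.trans neg_zero_le
  have hna : 0 ≤ -a := by
    have := neg_le_neg' h0
    rwa [neg_neg] at this
  have h1 : a + -w = -w := by rw [hw, ← add_neg_eq, ← add_assoc, h]
  have h2 : w ≤ -a := by
    have := add_width_self (-a)
    rw [width_neg] at this
    calc w ≤ -a + w := le_add_of_nonneg_left hna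
      _ = -a := this
  apply le_antisymm
  · exact le_neg_comm.1 h2
  · rw [neg_le_iff]
    -- If this failed, then `0 ≤ -a + -w = -w + -w ≤ -w` would give `-w = 0`, hence `a = 0`, for
    -- which the inequality is trivial.
    by_contra hlt
    have h3 : 0 ≤ -a + -w := by
      refine (nonneg_or _).resolve_right fun h' => hlt ?_
      rwa [← le_neg_iff, neg_neg] at h'
    have h4 : -w + -w = -w + -a := by
      calc -w + -w = -w + (a + -a) := by rw [add_neg_eq]
        _ = -w + -a := by rw [← add_assoc, add_comm (-w), h1]
    have h5 : -w = 0 := by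
      refine le_antisymm (neg_width_nonpos a) ?_
      calc 0 ≤ -a + -w := h3
        _ = -w + -w := by rw [h4, add_comm]
        _ ≤ -w := add_le_of_nonpos_left (neg_width_nonpos a)
    apply hlt
    have h6 : a = 0 := by rwa [h5, add_zero] at h1
    have h7 : w = 0 := by rw [hw, h6, width_zero]
    rw [h7] at h5
    rw [h6, h7, h5]

/-- An element `x` is invertible in the monoid of elements of its width, or it is in the maximal
subgroup at the idempotent `-w`, where `w` is its width. -/
theorem invertible_or (x : M) :
    (∃ y, width y = width x ∧ x + y = width x) ∨
      (-width x + -width x = -width x ∧ x + -width x = x) := by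
  by_cases hx : x + -width x = x
  · by_cases hi : -width x + -width x = -width x
    · exact Or.inr ⟨hi, hx⟩
    -- `x + -x` is `-width x`, and the second summand of the witness inverts that.
    · refine Or.inl ⟨-x + -(-width x + -width x), ?_, ?_⟩
      · have h := width_add (x := -width x) (y := -width x) le_rfl
        rw [width_neg, width_width] at h
        rw [width_add, width_neg, h]
        rw [width_neg, width_neg, h]
      · rw [← add_assoc, add_neg_eq, neg_width_add_inv hi]
  · left
    have hle : x + -width x ≤ x := add_le_of_nonpos_right (neg_width_nonpos x)
    have h0 : 0 ≤ x + -(x + -width x) := by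
      refine (nonneg_or _).resolve_right fun h' => hx (le_antisymm hle ?_)
      rwa [← le_neg_iff, neg_neg] at h'
    -- The witness is the residual of `width x` by `x`, so the sum is at most `width x`. The sum is
    -- nonnegative because `-width x` strictly lowers `x`.
    refine ⟨-(x + -width x), ?_, le_antisymm ?_ ?_⟩
    · rw [width_neg, add_comm, width_add]
      rw [width_neg, width_width]
    · rw [add_comm, add_le_iff]
    · calc width x ≤ width x + (x + -(x + -width x)) := le_add_of_nonneg_right h0
        _ = x + -(x + -width x) := by rw [← add_assoc, width_add_self]

theorem nonneg_iff_width_le : 0 ≤ x ↔ width x ≤ x := by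
  refine ⟨fun h => ?_, (width_nonneg x).trans⟩
  calc width x ≤ width x + x := le_add_of_nonneg_right h
    _ = x := width_add_self x

/-- Both inequalities can hold together only if `x = 0 = -0`, which the hypothesis excludes. -/
theorem not_nonneg_iff (h : width x ≠ 0 ∨ (-0 : M) ≠ 0) : ¬ 0 ≤ x ↔ x ≤ -0 := by
  refine ⟨(nonneg_or x).resolve_left, fun h1 h2 => ?_⟩
  have hd : (-0 : M) = 0 := le_antisymm neg_zero_le (h2.trans h1)
  rcases h with h | h
  · have : x = 0 := le_antisymm (h1.trans hd.le) h2
    exact h (by rw [this, width_zero])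
  · exact h hd

end Dom

/-! ### Idempotents and maximal subgroups -/

namespace Dom

variable {M : Type u} [Dom M]

/-- Idempotents of smaller width are absorbed by those of larger width, and at one width `w` the
only candidates are `w` and `-w`, with `w` absorbed by `-w`. -/
theorem idem_add_total {a b : M} (ha : a + a = a) (hb : b + b = b) : a + b = b ∨ b + a = a := by
  wlog h : width a ≤ width b generalizing a b
  · exact (this hb ha (le_of_not_ge h)).symm
  rcases idem_cases ha with h1 | h1
  · exact Or.inl (add_eq_of_le_width (h1 ▸ width_nonneg a) (by rwa [← h1] at h))
  · rcases h.lt_or_eq with h | h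
    · exact Or.inl (by rw [h1]; exact neg_width_add_of_lt h)
    · rcases idem_cases hb with h2 | h2
      · exact Or.inr (add_eq_of_le_width (h2 ▸ width_nonneg b) (by rw [h, ← h2]))
      · exact Or.inl (by rw [h1, h, ← h2, hb])

variable (M) in
/-- The idempotents of a dom, ordered by absorption. -/
@[ext]
structure Idem where
  /-- The underlying element. -/
  val : M
  idem : val + val = val

namespace Idem

instance : LE (Idem M) := ⟨fun i j => i.val + j.val = j.val⟩

theorem le_def {i j : Idem M} : i ≤ j ↔ i.val + j.val = j.val := Iff.rfl

noncomputable instance : LinearOrder (Idem M) where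
  le_refl i := i.idem
  le_trans i j k (h : _ = _) (h' : _ = _) := by
    rw [le_def, ← h', ← add_assoc, h]
  le_antisymm i j (h : _ = _) (h' : _ = _) := by
    ext
    rw [← h', add_comm, h]
  le_total i j := idem_add_total i.idem j.idem
  toDecidableLE := Classical.decRel _

instance : OrderBot (Idem M) where
  bot := ⟨0, add_zero 0⟩
  bot_le i := zero_add i.val

theorem bot_val : (⊥ : Idem M).val = 0 := rfl

end Idem

/-- The width of an element as an idempotent. -/
def widthIdem (x : M) : Idem M := ⟨width x, width_idem x⟩

theorem widthIdem_val (x : M) : (widthIdem x).val = width x := rfl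

theorem widthIdem_neg (x : M) : widthIdem (-x) = widthIdem x := Idem.ext (width_neg x)

theorem widthIdem_zero : widthIdem (0 : M) = ⊥ := Idem.ext width_zero

theorem widthIdem_le_iff {x y : M} : widthIdem x ≤ widthIdem y ↔ width x ≤ width y := by
  rw [Idem.le_def, widthIdem_val, widthIdem_val]
  constructor
  · intro h
    rw [← h]
    exact le_add_of_nonneg_right (width_nonneg y)
  · intro h
    exact add_eq_of_le_width (width_nonneg x) (by rwa [width_width])

theorem widthIdem_add {x y : M} (h : widthIdem x ≤ widthIdem y) :
    widthIdem (x + y) = widthIdem y :=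
  Idem.ext (width_add (widthIdem_le_iff.1 h))

theorem widthIdem_add_lt {x y : M} {i : Idem M} (hx : widthIdem x < i) (hy : widthIdem y < i) :
    widthIdem (x + y) < i := by
  rcases le_total (widthIdem x) (widthIdem y) with h | h
  · rwa [widthIdem_add h]
  · rwa [add_comm, widthIdem_add h]

/-- This is what makes `-x + i` an inverse of `x + i` in the subgroup at `i`. If `i` has the same
width as `x`, it can only be `-width x`. -/
theorem neg_width_add_of_widthIdem_lt {x : M} {i : Idem M} (h : widthIdem x < i) :
    -width x + i.val = i.val := by
  have hle : width x ≤ width i.val := le_width_iff.2 (Idem.le_def.1 h.le).le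
  rcases hle.lt_or_eq with h' | h'
  · exact neg_width_add_of_lt h'
  · rcases idem_cases i.idem with h1 | h1
    · exact absurd (Idem.ext (h'.trans h1.symm)) h.ne
    · rw [h', ← h1, i.idem]

/-- The maximal subgroup of a dom at an idempotent. -/
structure Grp (i : Idem M) where
  /-- The underlying element. -/
  val : M
  /-- The inverse of the underlying element. -/
  inv : M
  val_add : val + i.val = val
  inv_add : inv + i.val = inv
  add_inv : val + inv = i.val

namespace Grp

variable {i j k : Idem M}

@[ext]
theorem ext {a b : Grp i} (h : a.val = b.val) : a = b := by
  have h' : a.inv = b.inv := by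
    calc a.inv = a.inv + (b.val + b.inv) := by rw [b.add_inv, a.inv_add]
      _ = b.inv + (a.val + a.inv) := by rw [h]; ac_rfl
      _ = b.inv := by rw [a.add_inv, b.inv_add]
  cases a
  cases b
  simp_all

instance : Zero (Grp i) := ⟨⟨i.val, i.val, i.idem, i.idem, i.idem⟩⟩

instance : Add (Grp i) :=
  ⟨fun a b => ⟨a.val + b.val, a.inv + b.inv, by rw [add_assoc, b.val_add],
    by rw [add_assoc, b.inv_add],
    by rw [add_add_add_comm, a.add_inv, b.add_inv, i.idem]⟩⟩

instance : Neg (Grp i) :=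
  ⟨fun a => ⟨a.inv, a.val, a.inv_add, a.val_add, by rw [add_comm, a.add_inv]⟩⟩

theorem zero_val : (0 : Grp i).val = i.val := rfl
theorem add_val (a b : Grp i) : (a + b).val = a.val + b.val := rfl
theorem neg_val (a : Grp i) : (-a).val = a.inv := rfl

instance : AddCommGroup (Grp i) where
  add_assoc a b c := ext (add_assoc a.val b.val c.val)
  zero_add a := ext ((add_comm i.val a.val).trans a.val_add)
  add_zero a := ext a.val_add
  add_comm a b := ext (add_comm a.val b.val)
  neg_add_cancel a := ext ((add_comm a.inv a.val).trans a.add_inv)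
  nsmul := nsmulRec
  zsmul := zsmulRec

noncomputable instance : LinearOrder (Grp i) :=
  LinearOrder.lift' Grp.val fun _ _ => ext

theorem le_def {a b : Grp i} : a ≤ b ↔ a.val ≤ b.val := Iff.rfl
theorem lt_def {a b : Grp i} : a < b ↔ a.val < b.val := Iff.rfl

instance : IsOrderedAddMonoid (Grp i) where
  add_le_add_left _ _ h c := add_le_add_left (α := M) h c.val

theorem width_val (a : Grp i) : width a.val = width i.val := by
  apply le_antisymm
  · rw [← a.add_inv, add_comm]
    exact le_width_add
  · rw [← a.val_add]
    exact le_width_add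

/-- The translation by `j`, from the maximal subgroup at `i` to that at `j`, if `j` absorbs `i`
(and `0` otherwise). -/
noncomputable def trans (i j : Idem M) : Grp i →+ Grp j := by
  classical
  exact if h : i ≤ j then
    { toFun := fun a => ⟨a.val + j.val, a.inv + j.val, by rw [add_assoc, j.idem],
        by rw [add_assoc, j.idem], by
          rw [add_add_add_comm, a.add_inv, j.idem, Idem.le_def.1 h]⟩
      map_zero' := ext (Idem.le_def.1 h)
      map_add' := fun a b => ext (by
        change a.val + b.val + j.val = a.val + j.val + (b.val + j.val)
        rw [add_add_add_comm, j.idem]) }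
  else 0

theorem trans_val (h : i ≤ j) (a : Grp i) : (trans i j a).val = a.val + j.val := by
  rw [trans, dif_pos h]
  rfl

theorem trans_self (a : Grp i) : trans i i a = a :=
  ext (by rw [trans_val le_rfl, a.val_add])

theorem trans_trans (h : i ≤ j) (h' : j ≤ k) (a : Grp i) :
    trans j k (trans i j a) = trans i k a :=
  ext (by rw [trans_val h', trans_val h, trans_val (h.trans h'), add_assoc, Idem.le_def.1 h'])

theorem trans_mono (i j : Idem M) {a b : Grp i} (hab : a ≤ b) : trans i j a ≤ trans i j b := by
  by_cases h : i ≤ j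
  · rw [le_def, trans_val h, trans_val h]
    exact add_le_add_left (le_def.1 hab) _
  · rw [trans, dif_neg h]
    rfl

/-- The class `x + i` of `x` in the maximal subgroup at `i`, if the width of `x` is strictly
below `i` (and `0` otherwise). -/
noncomputable def cls (i : Idem M) (x : M) : Grp i := by
  classical
  exact if h : widthIdem x < i then
    ⟨x + i.val, -x + i.val, by rw [add_assoc, i.idem], by rw [add_assoc, i.idem], by
      rw [add_add_add_comm, add_neg_eq, i.idem, neg_width_add_of_widthIdem_lt h]⟩
  else 0

theorem cls_val {x : M} (h : widthIdem x < i) : (cls i x).val = x + i.val := by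
  rw [cls, dif_pos h]

theorem cls_zero (i : Idem M) : cls i 0 = 0 := by
  by_cases h : widthIdem 0 < i
  · exact ext (by rw [cls_val h, zero_add, zero_val])
  · rw [cls, dif_neg h]

theorem cls_neg (i : Idem M) (x : M) : cls i (-x) = -cls i x := by
  by_cases h : widthIdem x < i
  · apply ext
    rw [cls_val (by rwa [widthIdem_neg]), neg_val, cls, dif_pos h]
  · rw [cls, dif_neg (by rwa [widthIdem_neg]), cls, dif_neg h, neg_zero]

theorem cls_add {x y : M} (hx : widthIdem x < i) (hy : widthIdem y < i) :
    cls i (x + y) = cls i x + cls i y :=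
  ext (by rw [cls_val (widthIdem_add_lt hx hy), add_val, cls_val hx, cls_val hy,
    add_add_add_comm, i.idem])

theorem trans_cls {x : M} (h : widthIdem x < i) (h' : i ≤ j) : trans i j (cls i x) = cls j x :=
  ext (by rw [trans_val h', cls_val h, cls_val (h.trans_le h'), add_assoc, Idem.le_def.1 h'])

end Grp

end Dom

/-! ### The lifting group and its position relative to the dom -/

namespace Dom

open Grp

variable (M : Type u) [Dom M]

/-- Index set of the free part of the lifting group: an element `(i, n, a)` is a lift of the
element `a` of the maximal subgroup at `i ≠ 0`; the larger `n`, the smaller the generator. -/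
abbrev Gen : Type u := {i : Idem M // i ≠ ⊥} ×ₗ (ℕᵒᵈ ×ₗ M)

/-- The lifting group of a dom. -/
def Lift : Type u := Grp (⊥ : Idem M) × (Gen M →₀ ℤ)

noncomputable instance : AddCommGroup (Lift M) :=
  inferInstanceAs (AddCommGroup (Grp (⊥ : Idem M) × (Gen M →₀ ℤ)))

variable {M}

namespace Gen

/-- The idempotent of a generator. -/
def level (γ : Gen M) : Idem M := (ofLex γ).1.1

theorem bot_lt_level (γ : Gen M) : ⊥ < level γ := bot_lt_iff_ne_bot.2 (ofLex γ).1.2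

theorem level_mono {γ γ' : Gen M} (h : γ ≤ γ') : level γ ≤ level γ' :=
  Prod.Lex.monotone_fst _ _ h

/-- The element lifted by a generator. -/
noncomputable def value (γ : Gen M) : Grp (level γ) := by
  classical
  exact if h : ∃ a : Grp (level γ), a.val = (ofLex (ofLex γ).2).2 then h.choose else 0

/-- The generator lifting the element `a`. -/
def ofElement {i : Idem M} (hi : i ≠ ⊥) (n : ℕ) (a : Grp i) : Gen M :=
  toLex (⟨i, hi⟩, toLex (OrderDual.toDual n, a.val))

theorem value_ofElement {i : Idem M} (hi : i ≠ ⊥) (n : ℕ) (a : Grp i) : value (ofElement hi n a) = a := by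
  have h : ∃ b : Grp (level (ofElement hi n a)), b.val = (ofLex (ofLex (ofElement hi n a)).2).2 := ⟨a, rfl⟩
  rw [value, dif_pos h]
  exact Grp.ext h.choose_spec

/-- Below each generator there are generators of each level up to its own. -/
theorem exists_ofElement_lt (γ : Gen M) {i : Idem M} (hi : i ≠ ⊥) (hle : i ≤ level γ) :
    ∃ n : ℕ, ∀ a : Grp i, ofElement hi n a < γ := by
  refine ⟨OrderDual.ofDual (ofLex (ofLex γ).2).1 + 1, fun a => Prod.Lex.lt_iff.2 ?_⟩
  rcases hle.lt_or_eq with h | h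
  · exact Or.inl h
  · exact Or.inr ⟨Subtype.ext h, Prod.Lex.lt_iff.2 (Or.inl (Nat.lt_succ_self _))⟩

end Gen

open Gen

namespace Lift

variable {f g : Lift M} {x y : M} {i j : Idem M} {γ γ' : Gen M}

@[ext]
theorem ext (h1 : f.1 = g.1) (h2 : f.2 = g.2) : f = g := Prod.ext h1 h2

theorem add_snd (f g : Lift M) : (f + g).2 = f.2 + g.2 := rfl
theorem neg_snd (f : Lift M) : (-f).2 = -f.2 := rfl
theorem sub_snd (f g : Lift M) : (f - g).2 = f.2 - g.2 := rfl
theorem zero_snd : (0 : Lift M).2 = 0 := rfl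

/-- The class of an element of the lifting group in the maximal subgroup at `j`. Generators of
level above `j` are discarded. -/
noncomputable def phi (j : Idem M) : Lift M →+ Grp j :=
  (trans ⊥ j).comp (AddMonoidHom.fst (Grp (⊥ : Idem M)) (Gen M →₀ ℤ)) +
    (Finsupp.liftAddHom fun γ => zmultiplesHom (Grp j) (trans (level γ) j (value γ))).comp
      (AddMonoidHom.snd (Grp (⊥ : Idem M)) (Gen M →₀ ℤ))

theorem phi_apply (j : Idem M) (f : Lift M) : phi j f = trans ⊥ j f.1 +
    f.2.sum fun γ n => n • trans (level γ) j (value γ) := rfl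

/-- All generators in the support have level at most `j`. -/
def InLevel (j : Idem M) (f : Lift M) : Prop := ∀ γ, j < level γ → f.2 γ = 0

/-- All generators in the support are at most `γ`. -/
def Below (γ : Gen M) (f : Lift M) : Prop := ∀ γ', γ < γ' → f.2 γ' = 0

theorem InLevel.mono (h : InLevel i f) (hij : i ≤ j) : InLevel j f :=
  fun γ hγ => h γ (hij.trans_lt hγ)

theorem InLevel.add (hf : InLevel i f) (hg : InLevel i g) : InLevel i (f + g) := fun γ hγ => by
  rw [add_snd, Finsupp.add_apply, hf γ hγ, hg γ hγ, add_zero]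

theorem InLevel.sub (hf : InLevel i f) (hg : InLevel i g) : InLevel i (f - g) := fun γ hγ => by
  rw [sub_snd, Finsupp.sub_apply, hf γ hγ, hg γ hγ, sub_zero]

theorem InLevel.neg (hf : InLevel i f) : InLevel i (-f) := fun γ hγ => by
  rw [neg_snd, Finsupp.neg_apply, hf γ hγ, neg_zero]

theorem inLevel_zero : InLevel i (0 : Lift M) := fun _ _ => rfl

theorem Below.mono (h : Below γ f) (hγ : γ ≤ γ') : Below γ' f :=
  fun _ hδ => h _ (hγ.trans_lt hδ)

theorem Below.add (hf : Below γ f) (hg : Below γ g) : Below γ (f + g) := fun δ hδ => by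
  rw [add_snd, Finsupp.add_apply, hf δ hδ, hg δ hδ, add_zero]

theorem Below.sub (hf : Below γ f) (hg : Below γ g) : Below γ (f - g) := fun δ hδ => by
  rw [sub_snd, Finsupp.sub_apply, hf δ hδ, hg δ hδ, sub_zero]

theorem Below.neg (hf : Below γ f) : Below γ (-f) := fun δ hδ => by
  rw [neg_snd, Finsupp.neg_apply, hf δ hδ, neg_zero]

theorem Below.inLevel (h : Below γ f) : InLevel (level γ) f :=
  fun _ hδ => h _ (lt_of_not_ge fun h' => (level_mono h').not_gt hδ)

theorem InLevel.below (h : InLevel i f) (hi : i < level γ) : Below γ f :=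
  fun _ hδ => h _ (hi.trans_le (level_mono hδ.le))

/-- The level bound is needed because `phi i` discards generators of level above `i`, which `phi j`
may keep. -/
theorem phi_trans (hf : InLevel i f) (hij : i ≤ j) : phi j f = trans i j (phi i f) := by
  rw [phi_apply, phi_apply, map_add, trans_trans bot_le hij, map_finsuppSum]
  congr 1
  refine Finsupp.sum_congr fun γ hγ => ?_
  have : level γ ≤ i := le_of_not_gt fun h => Finsupp.mem_support_iff.1 hγ (hf γ h)
  rw [map_zsmul, trans_trans this hij]

/-- The class at the level of `γ`, together with the coefficient of `γ`. -/
noncomputable def psi (γ : Gen M) : Lift M →+ Grp (level γ) ×ₗ ℤ where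
  toFun f := toLex (phi (level γ) f, f.2 γ)
  map_zero' := by
    rw [map_zero, zero_snd]
    rfl
  map_add' f g := by
    rw [map_add, add_snd]
    rfl

theorem psi_apply (γ : Gen M) (f : Lift M) : psi γ f = toLex (phi (level γ) f, f.2 γ) := rfl

/-- The class of an element of the dom, in the target of `psi γ`. -/
noncomputable def elementClass (γ : Gen M) (x : M) : Grp (level γ) ×ₗ ℤ :=
  toLex (cls (level γ) x, 0)

theorem elementClass_neg (γ : Gen M) (x : M) : elementClass γ (-x) = -elementClass γ x := by
  rw [elementClass, cls_neg, elementClass]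
  rfl

theorem elementClass_zero (γ : Gen M) : elementClass γ (0 : M) = 0 := by
  rw [elementClass, cls_zero]
  rfl

theorem elementClass_add (hx : widthIdem x < level γ) (hy : widthIdem y < level γ) :
    elementClass γ (x + y) = elementClass γ x + elementClass γ y := by
  rw [elementClass, cls_add hx hy]
  rfl

/-- At a larger generator the coefficient of `f` vanishes and classes are only translated, so a
strict inequality may become an equality; the weak one survives. -/
theorem psi_le_mono (hf : Below γ f) (hγ : γ ≤ γ') (hx : widthIdem x < level γ)
    (h : psi γ f ≤ elementClass γ x) : psi γ' f ≤ elementClass γ' x := by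
  rcases hγ.eq_or_lt with rfl | hγ
  · exact h
  have hl := level_mono hγ.le
  rw [psi_apply, elementClass, Prod.Lex.toLex_le_toLex'] at h ⊢
  refine ⟨?_, fun _ => (hf γ' hγ).le⟩
  change phi (level γ') f ≤ cls (level γ') x
  rw [phi_trans hf.inLevel hl, ← trans_cls hx hl]
  exact trans_mono _ _ h.1

theorem le_psi_mono (hf : Below γ f) (hγ : γ ≤ γ') (hx : widthIdem x < level γ)
    (h : elementClass γ x ≤ psi γ f) : elementClass γ' x ≤ psi γ' f := by
  have := psi_le_mono (x := -x) hf.neg hγ (by rwa [widthIdem_neg])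
    (by rwa [map_neg, elementClass_neg, neg_le_neg_iff])
  rwa [map_neg, elementClass_neg, neg_le_neg_iff] at this

/-- Either the supports of `f` and `g` are in level `j`, or there is a last generator in their
union, and it is of level above `j`. -/
theorem inLevel_or_exists_last (j : Idem M) (f g : Lift M) : (InLevel j f ∧ InLevel j g) ∨
    ∃ γ, j < level γ ∧ Below γ f ∧ Below γ g ∧ (f.2 γ ≠ 0 ∨ g.2 γ ≠ 0) := by
  classical
  by_cases h : InLevel j f ∧ InLevel j g
  · exact Or.inl h
  right
  have hex : ∃ γ ∈ f.2.support ∪ g.2.support, j < level γ := by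
    simp only [Finset.mem_union, Finsupp.mem_support_iff]
    contrapose! h
    refine ⟨fun γ hγ => ?_, fun γ hγ => ?_⟩ <;> by_contra h'
    · exact (h γ (Or.inl h')).not_gt hγ
    · exact (h γ (Or.inr h')).not_gt hγ
  obtain ⟨δ, hδ, hjδ⟩ := hex
  have hne : (f.2.support ∪ g.2.support).Nonempty := ⟨δ, hδ⟩
  refine ⟨(f.2.support ∪ g.2.support).max' hne,
    hjδ.trans_le (level_mono (Finset.le_max' _ _ hδ)), fun γ hγ => ?_, fun γ hγ => ?_, ?_⟩
  · by_contra h'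
    exact (Finset.le_max' _ γ
      (Finset.mem_union_left _ (Finsupp.mem_support_iff.2 h'))).not_gt hγ
  · by_contra h'
    exact (Finset.le_max' _ γ
      (Finset.mem_union_right _ (Finsupp.mem_support_iff.2 h'))).not_gt hγ
  · simpa using Finset.max'_mem _ hne

/-- The element `f` of the lifting group is to be placed below the element `x` of the dom. -/
def Under (f : Lift M) (x : M) : Prop :=
  (InLevel (widthIdem x) f ∧ (phi (widthIdem x) f).val ≤ x) ∨
    ∃ γ, widthIdem x < level γ ∧ Below γ f ∧ psi γ f < elementClass γ x

/-- The generator witnessing `Under` does not matter: every admissible comparison agrees weakly with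
it. -/
theorem Under.psi_le (h : Under f x) (hf : Below γ f) (hx : widthIdem x < level γ) :
    psi γ f ≤ elementClass γ x := by
  rcases h with ⟨h1, h2⟩ | ⟨γ', hx', hf', h⟩
  · rw [psi_apply, elementClass, Prod.Lex.toLex_le_toLex']
    refine ⟨?_, fun _ => (h1 γ hx).le⟩
    change phi (level γ) f ≤ cls (level γ) x
    rw [phi_trans h1 hx.le, Grp.le_def, trans_val hx.le, cls_val hx]
    exact add_le_add_left h2 _
  · rcases le_total γ' γ with hγ | hγ
    · exact psi_le_mono hf' hγ hx' h.le
    · exact le_of_not_gt fun h' => (le_psi_mono hf hγ hx h'.le).not_gt h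

theorem phi_le_cls_of_psi_le (h : psi γ f ≤ elementClass γ x) :
    phi (level γ) f ≤ cls (level γ) x :=
  (Prod.Lex.toLex_le_toLex'.1 h).1

theorem Under.phi_le (h : Under f x) (hf : InLevel j f) (hx : widthIdem x ≤ j) :
    (phi j f).val ≤ x + j.val := by
  rcases h with ⟨h1, h2⟩ | ⟨γ, hγ, hf', h⟩
  · rw [phi_trans h1 hx, trans_val hx]
    exact add_le_add_left h2 _
  · have hle := phi_le_cls_of_psi_le h.le
    rcases le_or_gt (level γ) j with hj | hj
    · rw [phi_trans hf'.inLevel hj]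
      refine (Grp.le_def.1 (trans_mono _ j hle)).trans ?_
      rw [trans_cls hγ hj, cls_val (hγ.trans_le hj)]
    -- The coefficient of `f` at `γ` is zero, so strictness comes from the classes, and translating
    -- the opposite inequality from level `j` contradicts it.
    · by_contra hlt
      have h2 : psi γ f < elementClass γ x := h
      rw [psi_apply, elementClass, Prod.Lex.toLex_lt_toLex'] at h2
      have hne : phi (level γ) f < cls (level γ) x :=
        lt_of_le_of_ne h2.1 fun he => (h2.2 he).ne (hf γ hj)
      rw [phi_trans hf hj.le, Grp.lt_def, trans_val hj.le, cls_val hγ] at hne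
      refine hne.not_ge ?_
      calc x + (level γ).val = (x + j.val) + (level γ).val := by
            rw [add_assoc, Idem.le_def.1 hj.le]
        _ ≤ _ := add_le_add_left (le_of_not_ge hlt) _

theorem under_iff_of_inLevel (hf : InLevel (widthIdem x) f) :
    Under f x ↔ (phi (widthIdem x) f).val ≤ x := by
  refine ⟨fun h => ?_, fun h => Or.inl ⟨hf, h⟩⟩
  have := h.phi_le hf le_rfl
  rwa [widthIdem_val, add_width_self] at this

theorem under_iff_of_below (hf : Below γ f) (hx : widthIdem x < level γ)
    (hne : psi γ f ≠ elementClass γ x) : Under f x ↔ psi γ f < elementClass γ x :=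
  ⟨fun h => lt_of_le_of_ne (h.psi_le hf hx) hne, fun h => Or.inr ⟨γ, hx, hf, h⟩⟩

theorem psi_ne (h : f.2 γ ≠ 0) : psi γ f ≠ elementClass γ x :=
  fun h' => h (congrArg (fun p => (ofLex p).2) h')

theorem under_zero_iff : Under 0 x ↔ 0 ≤ x := by
  rw [under_iff_of_inLevel inLevel_zero, map_zero, zero_val, widthIdem_val, nonneg_iff_width_le]

/-- At the level of `x` this is the dichotomy of `not_nonneg_iff`, applied to an element with the
width of `x`. Beyond that level the last coefficient of `f` is nonzero, so no tie with `x` is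
possible. -/
theorem under_neg_iff (hx : width x ≠ 0 ∨ (-0 : M) ≠ 0) : Under f (-x) ↔ ¬ Under (-f) x := by
  rcases inLevel_or_exists_last (widthIdem x) f f with ⟨hf, -⟩ | ⟨γ, hγ, hf, -, hne⟩
  · rw [under_iff_of_inLevel (by rwa [widthIdem_neg]), under_iff_of_inLevel hf.neg,
      widthIdem_neg, map_neg, neg_val]
    set s := phi (widthIdem x) f with hs
    have hw : width (s.val + x) = width x := width_add (by
      rw [width_val, widthIdem_val, width_width])
    rw [le_neg_iff, ← not_nonneg_iff (by rwa [hw]), not_iff_not, nonneg_iff_width_le, hw]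
    have hadd : s.val + s.inv = width x := s.add_inv
    have hinv : s.inv + width x = s.inv := s.inv_add
    constructor
    · intro h
      calc s.inv = s.inv + width x := hinv.symm
        _ ≤ s.inv + (s.val + x) := add_le_add_right h _
        _ = x := by rw [← add_assoc, add_comm s.inv, hadd, width_add_self]
    · intro h
      calc width x = s.val + s.inv := hadd.symm
        _ ≤ s.val + x := add_le_add_right h _
  · have hne : f.2 γ ≠ 0 := hne.elim id id
    rw [under_iff_of_below hf (by rwa [widthIdem_neg]) (psi_ne hne),
      under_iff_of_below hf.neg hγ (psi_ne (by rwa [neg_snd, Finsupp.neg_apply, neg_ne_zero])),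
      elementClass_neg, map_neg, not_lt, le_neg]
    refine ⟨le_of_lt, fun h => lt_of_le_of_ne h ?_⟩
    rw [← elementClass_neg]
    exact psi_ne hne

/-- Both inequalities are moved to a common place: the larger width, or the last generator of either
summand. In the latter case a nonzero coefficient makes one of them strict. -/
theorem Under.add (hf : Under f x) (hg : Under g y) : Under (f + g) (x + y) := by
  wlog hxy : widthIdem x ≤ widthIdem y generalizing f g x y
  · rw [add_comm f, add_comm x]
    exact this hg hf (le_of_not_ge hxy)
  have hw := widthIdem_add hxy
  rcases inLevel_or_exists_last (widthIdem y) f g with ⟨hf', hg'⟩ | ⟨γ, hγ, hf', hg', hne⟩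
  · rw [under_iff_of_inLevel (by rw [hw]; exact hf'.add hg'), hw, map_add, add_val]
    calc (phi (widthIdem y) f).val + (phi (widthIdem y) g).val
        ≤ (x + (widthIdem y).val) + (y + (widthIdem y).val) :=
          add_le_add (hf.phi_le hf' hxy) (hg.phi_le hg' le_rfl)
      _ = x + y := by rw [add_add_add_comm, Idem.idem, add_assoc, widthIdem_val, add_width_self]
  · refine Or.inr ⟨γ, by rwa [hw], hf'.add hg', ?_⟩
    rw [map_add, elementClass_add (hxy.trans_lt hγ) hγ]
    have h1 := hf.psi_le hf' (hxy.trans_lt hγ)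
    have h2 := hg.psi_le hg' hγ
    rcases hne with hne | hne
    · exact add_lt_add_of_lt_of_le (lt_of_le_of_ne h1 (psi_ne hne)) h2
    · exact add_lt_add_of_le_of_lt h1 (lt_of_le_of_ne h2 (psi_ne hne))

/-- The opposite of a generator lifting `-a`: a lift of `a` with coefficient `-1`. -/
noncomputable def negGen (hi : i ≠ ⊥) (n : ℕ) (a : Grp i) : Lift M :=
  (0, Finsupp.single (ofElement hi n (-a)) (-1))

theorem negGen_snd (hi : i ≠ ⊥) (n : ℕ) (a : Grp i) :
    (negGen hi n a).2 = Finsupp.single (ofElement hi n (-a)) (-1) := rfl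

theorem phi_negGen (hi : i ≠ ⊥) (n : ℕ) (a : Grp i) : phi i (negGen hi n a) = a := by
  rw [phi_apply, negGen_snd, Finsupp.sum_single_index (by rw [zero_smul])]
  change trans ⊥ i 0 + (-1 : ℤ) • trans i i (value (ofElement hi n (-a))) = a
  rw [value_ofElement, trans_self, map_zero, zero_add, neg_smul, one_smul, neg_neg]

theorem below_negGen (hi : i ≠ ⊥) (n : ℕ) (a : Grp i) :
    Below (ofElement hi n (-a)) (negGen hi n a) := fun _ h => Finsupp.single_eq_of_ne h.ne'

theorem inLevel_negGen (hi : i ≠ ⊥) (n : ℕ) (a : Grp i) : InLevel i (negGen hi n a) :=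
  (below_negGen hi n a).inLevel

theorem under_negGen_cls (hi : i ≠ ⊥) (n : ℕ) (hx : widthIdem x < i) :
    Under (negGen hi n (cls i x)) x := by
  refine Or.inr ⟨ofElement hi n (-cls i x), hx, below_negGen hi n _, ?_⟩
  rw [psi_apply, elementClass, Prod.Lex.toLex_lt_toLex']
  refine ⟨(phi_negGen hi n _).le, fun _ => ?_⟩
  change (negGen hi n (cls i x)).2 (ofElement hi n (-cls i x)) < 0
  rw [negGen_snd, Finsupp.single_eq_same]
  norm_num

/-- An element of the maximal subgroup at `0` as an element of the lifting group. -/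
def ofBot (a : Grp (⊥ : Idem M)) : Lift M := (a, 0)

theorem phi_ofBot (j : Idem M) (a : Grp (⊥ : Idem M)) : phi j (ofBot a) = trans ⊥ j a := by
  rw [phi_apply]
  change trans ⊥ j a + Finsupp.sum 0 _ = _
  rw [Finsupp.sum_zero_index, add_zero]

theorem inLevel_ofBot (j : Idem M) (a : Grp (⊥ : Idem M)) : InLevel j (ofBot a) := fun _ _ => rfl

theorem exists_phi_eq (a : Grp i) : ∃ f, InLevel i f ∧ phi i f = a := by
  by_cases hi : i = ⊥
  · subst hi
    exact ⟨ofBot a, inLevel_ofBot _ a, by rw [phi_ofBot, trans_self]⟩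
  · exact ⟨_, inLevel_negGen hi 0 a, phi_negGen hi 0 a⟩

/-- `Under` splits along sums of two elements of the same width `w`, the first of which is
invertible in the monoid of elements of width `w`. -/
theorem Under.split_invertible (hxy : widthIdem x = widthIdem y)
    (hf : InLevel (widthIdem y) f) (h : Under f (x + y))
    (hx : ∃ z, width z = width x ∧ x + z = width x) : ∃ g, Under g x ∧ Under (f - g) y := by
  obtain ⟨z, hz, hxz⟩ := hx
  let a : Grp (widthIdem x) :=
    ⟨x, z, add_width_self x, by rw [widthIdem_val, ← hz, add_width_self], hxz⟩
  obtain ⟨g, hg, hga⟩ := exists_phi_eq a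
  refine ⟨g, (under_iff_of_inLevel hg).2 (by rw [hga]), ?_⟩
  have hw := widthIdem_add hxy.le
  rw [under_iff_of_inLevel (by rwa [hw]), hw, ← hxy] at h
  rw [under_iff_of_inLevel (by rw [← hxy] at hf ⊢; exact hf.sub hg), ← hxy, map_sub, hga,
    sub_eq_add_neg, add_val]
  calc (phi (widthIdem x) f).val + z ≤ x + y + z := add_le_add_left h _
    _ = y + (x + z) := by ac_rfl
    _ = y := by
      have : width x = width y := congrArg Idem.val hxy
      rw [hxz, this, add_width_self]

/-- Interpolation: the left part of the cut at `x + y` contains nothing beyond sums. Unless an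
invertible summand can be lifted exactly, `g` is an opposite of a generator, with the class of `x`
but placed infinitesimally below `x`; the slack in `Under f (x + y)` then accommodates `f - g`. -/
theorem Under.split (h : Under f (x + y)) : ∃ g, Under g x ∧ Under (f - g) y := by
  wlog hxy : widthIdem x ≤ widthIdem y generalizing x y
  · rw [add_comm] at h
    obtain ⟨g, h1, h2⟩ := this h (le_of_not_ge hxy)
    exact ⟨f - g, h2, by rwa [sub_sub_cancel]⟩
  have hw := widthIdem_add hxy
  by_cases hf : InLevel (widthIdem y) f
  · rcases hxy.eq_or_lt with he | hlt
    · have hwe : width x = width y := congrArg Idem.val he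
      rcases invertible_or x with hx | ⟨hi, hx⟩
      · exact h.split_invertible he hf hx
      rcases invertible_or y with hy | ⟨-, hy⟩
      · rw [add_comm] at h
        obtain ⟨g, h1, h2⟩ := h.split_invertible he.symm (by rwa [he]) hy
        exact ⟨f - g, h2, by rwa [sub_sub_cancel]⟩
      -- Neither `x` nor `y` is invertible at their common width, so both lie in the maximal
      -- subgroup at `-width x`, and `x` is lifted from there.
      let e : Idem M := ⟨-width x, hi⟩
      have hle : widthIdem x ≤ e := add_neg_width x
      rcases hle.eq_or_lt with hxe | hxe
      · refine h.split_invertible he hf ⟨-x, width_neg x, ?_⟩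
        rw [add_neg_eq]
        exact (congrArg Idem.val hxe).symm
      have hye : widthIdem y < e := he ▸ hxe
      have he0 : e ≠ ⊥ := (bot_le.trans_lt hxe).ne'
      refine ⟨negGen he0 0 (cls e x), under_negGen_cls he0 0 hxe, ?_⟩
      have hbelow : Below (ofElement he0 0 (-cls e x)) f := hf.below hye
      refine Or.inr ⟨ofElement he0 0 (-cls e x), hye, hbelow.sub (below_negGen _ _ _), ?_⟩
      refine Prod.Lex.toLex_lt_toLex.2 (Or.inl ?_)
      change phi e (f - negGen he0 0 (cls e x)) < cls e y
      rw [map_sub, phi_negGen, sub_lt_iff_lt_add', ← cls_add hxe hye]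
      refine lt_of_le_of_ne ?_ fun heq => ?_
      · rw [Grp.le_def, cls_val (by rw [hw]; exact hye)]
        exact h.phi_le (hf.mono hye.le) (hw.trans_le hye.le)
      -- Equality of classes at `e` would make `e` fix the class of `f` at the common width;
      -- cancelling that class, `e` would be absorbed by the width, although it is strictly above
      -- it.
      · rw [under_iff_of_inLevel (by rwa [hw]), hw] at h
        rw [phi_trans hf hye.le, Grp.ext_iff, trans_val hye.le,
          cls_val (by rw [hw]; exact hye)] at heq
        have hxy' : x + y + e.val = x + y := by
          change x + y + -width x = x + y
          rw [hwe, add_assoc, hy]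
        rw [hxy'] at heq
        have h1 : (phi (widthIdem y) f).val + e.val = (phi (widthIdem y) f).val := by
          refine le_antisymm ?_ ?_
          · exact add_le_of_nonpos_right (neg_width_nonpos x)
          · rw [heq]; exact h
        have h2 : (widthIdem y).val + e.val = (widthIdem y).val := by
          have := congrArg (fun t => (phi (widthIdem y) f).inv + t) h1
          simp only [← add_assoc] at this
          rwa [add_comm (phi (widthIdem y) f).inv, Grp.add_inv] at this
        exact hye.not_ge (by rw [Idem.le_def, add_comm]; exact h2)
    · have h0 : widthIdem y ≠ ⊥ := (bot_le.trans_lt hlt).ne'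
      refine ⟨negGen h0 0 (cls _ x), under_negGen_cls h0 0 hlt, ?_⟩
      rw [under_iff_of_inLevel (hf.sub (inLevel_negGen h0 0 _)), map_sub, phi_negGen]
      rw [under_iff_of_inLevel (by rwa [hw]), hw] at h
      rw [sub_eq_add_neg, ← cls_neg, add_val, cls_val (by rwa [widthIdem_neg]), widthIdem_val]
      calc (phi (widthIdem y) f).val + (-x + width y) ≤ x + y + (-x + width y) :=
            add_le_add_left h _
        _ = (y + width y) + (x + -x) := by ac_rfl
        _ = y := by
          rw [add_width_self, add_neg_eq, add_comm]
          refine neg_width_add_of_lt (lt_of_not_ge fun h' => hlt.not_ge ?_)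
          exact widthIdem_le_iff.2 h'
  · rcases h with ⟨h1, -⟩ | ⟨γ, hγ, hf', h⟩
    · exact absurd (hw ▸ h1) hf
    rw [hw] at hγ
    -- The index `n` is large enough for the generator in `g` to be smaller than `γ`; subtracting
    -- `g` then leaves the coefficient at `γ` unchanged.
    obtain ⟨n, hn⟩ := exists_ofElement_lt γ (bot_lt_level γ).ne' le_rfl
    have hx := hxy.trans_lt hγ
    set g := negGen (bot_lt_level γ).ne' n (cls (level γ) x) with hg
    have hgb : Below γ g := (below_negGen _ _ _).mono (hn _).le
    refine ⟨g, under_negGen_cls _ _ hx, Or.inr ⟨γ, hγ, hf'.sub hgb, ?_⟩⟩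
    have hpsi : psi γ g = elementClass γ x := by
      rw [psi_apply, elementClass, hg, phi_negGen, negGen_snd, Finsupp.single_eq_of_ne (hn _).ne']
    rw [map_sub, hpsi, sub_lt_iff_lt_add', ← elementClass_add hx hγ]
    exact h

end Lift

end Dom

/-! ### The order of the lifting group and the map to cuts -/

namespace Dom

open Grp Gen

variable {M : Type u} [Dom M]

namespace Lift

variable {f g : Lift M} {x y : M} {γ : Gen M}

theorem snd_eq_zero_of_inLevel (h : InLevel ⊥ f) : f.2 = 0 :=
  Finsupp.ext fun γ => h γ (bot_lt_level γ)

theorem eq_ofBot_of_inLevel (h : InLevel ⊥ f) : f = ofBot f.1 :=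
  ext rfl (snd_eq_zero_of_inLevel h)

theorem ofBot_sub (a b : Grp (⊥ : Idem M)) : ofBot (a - b) = ofBot a - ofBot b :=
  ext rfl (sub_zero 0).symm

theorem ofBot_neg (a : Grp (⊥ : Idem M)) : ofBot (-a) = -ofBot a :=
  ext rfl neg_zero.symm

theorem ofBot_add (a b : Grp (⊥ : Idem M)) : ofBot (a + b) = ofBot a + ofBot b :=
  ext rfl (add_zero 0).symm

theorem under_ofBot_iff {a : Grp (⊥ : Idem M)} : Under (ofBot a) x ↔ a.val ≤ x := by
  rw [under_iff_of_inLevel (inLevel_ofBot _ a), phi_ofBot, trans_val bot_le, widthIdem_val]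
  constructor
  · exact (le_add_of_nonneg_right (width_nonneg x)).trans
  · intro h
    calc a.val + width x ≤ x + width x := add_le_add_left h _
      _ = x := add_width_self x

theorem under_sub_ofBot_iff {a : Grp (⊥ : Idem M)} :
    Under (f - ofBot a) y ↔ Under f (a.val + y) := by
  constructor
  · intro h
    have := (under_ofBot_iff.2 (le_refl a.val)).add h
    rwa [add_sub_cancel] at this
  · intro h
    have := (under_ofBot_iff.2 (le_refl (-a).val)).add h
    rwa [ofBot_neg, neg_add_eq_sub, neg_val, ← add_assoc, add_comm a.inv, a.add_inv,
      Idem.bot_val, zero_add] at this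

theorem Under.psi_nonpos (h : Under f 0) (hf : Below γ f) : psi γ f ≤ 0 := by
  have := h.psi_le hf (by rw [widthIdem_zero]; exact bot_lt_level γ)
  rwa [elementClass_zero] at this

theorem under_zero_of_psi_neg (hf : Below γ f) (h : psi γ f < 0) : Under f 0 :=
  Or.inr ⟨γ, by rw [widthIdem_zero]; exact bot_lt_level γ, hf, by rwa [elementClass_zero]⟩

theorem psi_ne_zero (h : f.2 γ ≠ 0) : psi γ f ≠ 0 := by
  rw [← elementClass_zero]
  exact psi_ne h

theorem inLevel_bot_or_exists_last (f : Lift M) : InLevel ⊥ f ∨ ∃ γ, Below γ f ∧ f.2 γ ≠ 0 := by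
  rcases inLevel_or_exists_last ⊥ f f with ⟨h, -⟩ | ⟨γ, -, h, -, h'⟩
  · exact Or.inl h
  · exact Or.inr ⟨γ, h, h'.elim id id⟩

/-- The lifting group is ordered by the position relative to the element `0` of the dom. -/
instance : LE (Lift M) := ⟨fun f g => Under (f - g) 0⟩

theorem le_def : f ≤ g ↔ Under (f - g) 0 := Iff.rfl

noncomputable instance : LinearOrder (Lift M) where
  le_refl f := by rw [le_def, sub_self, under_zero_iff]
  le_trans f g h h1 h2 := by
    have := Under.add h1 h2
    rwa [sub_add_sub_cancel, add_zero] at this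
  le_antisymm f g h1 h2 := by
    rw [← sub_eq_zero]
    rw [le_def] at h1 h2
    rw [← neg_sub] at h2
    generalize f - g = h at h1 h2
    rcases inLevel_bot_or_exists_last h with hb | ⟨γ, hγ, hne⟩
    · rw [eq_ofBot_of_inLevel hb, under_ofBot_iff] at h1
      rw [eq_ofBot_of_inLevel hb, ← ofBot_neg, under_ofBot_iff] at h2
      have h3 : h.1 ≤ 0 := h1
      have h4 : -h.1 ≤ 0 := h2
      exact ext (le_antisymm h3 (neg_nonpos.1 h4)) (snd_eq_zero_of_inLevel hb)
    · have h3 := h2.psi_nonpos hγ.neg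
      rw [map_neg, neg_nonpos] at h3
      exact absurd (le_antisymm (h1.psi_nonpos hγ) h3) (psi_ne_zero hne)
  le_total f g := by
    rw [le_def, le_def, ← neg_sub f g]
    generalize f - g = h
    rcases inLevel_bot_or_exists_last h with hb | ⟨γ, hγ, hne⟩
    · rw [eq_ofBot_of_inLevel hb, ← ofBot_neg, under_ofBot_iff, under_ofBot_iff]
      exact (le_total h.1 0).imp id neg_nonpos.2
    · refine (psi_ne_zero hne).lt_or_gt.imp (under_zero_of_psi_neg hγ) fun h' => ?_
      exact under_zero_of_psi_neg hγ.neg (by rwa [map_neg, neg_lt_zero])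
  toDecidableLE := Classical.decRel _

instance : IsOrderedAddMonoid (Lift M) where
  add_le_add_left f g h c := by rwa [le_def, add_sub_add_right_eq_sub]

theorem nonpos_iff : f ≤ 0 ↔ Under f 0 := by rw [le_def, sub_zero]

theorem ofBot_le_ofBot_iff {a b : Grp (⊥ : Idem M)} : ofBot a ≤ ofBot b ↔ a ≤ b := by
  rw [le_def, ← ofBot_sub, under_ofBot_iff]
  exact sub_nonpos (a := a) (b := b)

theorem ofBot_zero : ofBot (0 : Grp (⊥ : Idem M)) = 0 := rfl

theorem psi_pos_of_pos (h : 0 < f) (hf : Below γ f) (hne : f.2 γ ≠ 0) : 0 < psi γ f :=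
  lt_of_not_ge fun h' => h.not_ge
    (nonpos_iff.2 (under_zero_of_psi_neg hf (lt_of_le_of_ne h' (psi_ne_zero hne))))

theorem pos_of_psi_pos (hf : Below γ f) (h : 0 < psi γ f) : 0 < f :=
  lt_of_not_ge fun h' => ((nonpos_iff.1 h').psi_nonpos hf).not_gt h

/-- The cut of the lifting group at an element of the dom. -/
def cutAt (x : M) : Cut (Lift M) where
  left := {f | Under f x}
  right := {f | ¬ Under f x}
  union_eq := Set.union_compl_self _
  lt a ha b hb := lt_of_not_ge fun h => hb (by
    have := Under.add (le_def.1 h) ha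
    rwa [sub_add_cancel, zero_add] at this)

theorem mem_cutAt : f ∈ (cutAt x).left ↔ Under f x := Iff.rfl

theorem cutAt_zero : cutAt (0 : M) = 0 :=
  Cut.ext_left fun f => by rw [Cut.mem_zero, mem_cutAt, nonpos_iff]

theorem cutAt_add (x y : M) : cutAt (x + y) = cutAt x + cutAt y :=
  Cut.ext_left fun f => by
    rw [Cut.mem_add]
    refine ⟨Under.split, fun ⟨g, hg, hg'⟩ => ?_⟩
    have := Under.add (mem_cutAt.1 hg) (mem_cutAt.1 hg')
    rwa [add_sub_cancel] at this

theorem cutAt_neg (hx : width x ≠ 0 ∨ (-0 : M) ≠ 0) : cutAt (-x) = -cutAt x :=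
  Cut.ext_left fun f => by rw [Cut.mem_neg, mem_cutAt, mem_cutAt, under_neg_iff hx]

/-- If `x ≤ y` fails, then `0 ≤ x + -y`, and splitting `0` gives some `g` under `x` with `-g` under
`-y`, that is, `g` not under `y`. Conversely, such a `g` yields `0 ≤ x + -y` by `Under.add`. -/
theorem cutAt_le_cutAt_iff (hy : width y ≠ 0 ∨ (-0 : M) ≠ 0) :
    cutAt x ≤ cutAt y ↔ x ≤ y := by
  have hle : x ≤ y ↔ x + -y ≤ -0 := by rw [← le_neg_iff, neg_neg]
  constructor
  · intro h
    by_contra h'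
    rw [hle] at h'
    obtain ⟨g, h1, h2⟩ := (under_zero_iff.2 ((nonneg_or _).resolve_right h')).split
    rw [under_neg_iff hy, zero_sub, neg_neg] at h2
    exact h2 (h h1)
  · intro h f hf
    by_contra h'
    have h2 : Under (-f) (-y) := by rwa [under_neg_iff hy, neg_neg]
    have h3 := Under.add hf h2
    rw [add_neg_cancel, under_zero_iff] at h3
    refine (not_nonneg_iff (hy.imp_left fun hy0 h0 => hy0 ?_)).2 (hle.1 h) h3
    refine le_antisymm ?_ (width_nonneg y)
    rw [← h0, ← width_neg]
    exact le_width_add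

theorem translate_cutAt (a : Grp (⊥ : Idem M)) :
    (cutAt y).translate (ofBot a) = cutAt (a.val + y) :=
  Cut.ext_left fun f => by rw [Cut.mem_translate, mem_cutAt, mem_cutAt, under_sub_ofBot_iff]

/-- `δ` is a unit with inverse `d`. No element of `M` lies strictly between `δ` and `0`, so `d` is
the least positive unit. Its class is trivial at every nonzero level, so it is also below every
positive element involving a generator. -/
theorem discretelyOrdered (h : (-0 : M) + -0 ≠ -0) : DiscretelyOrdered (Lift M) := by
  have hinv : (-0 : M) + -(-0 + -0) = 0 := by
    have := neg_width_add_inv (x := (0 : M))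
    rw [width_zero] at this
    exact this h
  let d : Grp (⊥ : Idem M) := ⟨-(-0 + -0), -0, add_zero _, add_zero _, by rw [add_comm, hinv]; rfl⟩
  have hd0 : (-0 : M) < 0 := lt_of_le_of_ne neg_zero_le fun h0 => h (by rw [h0, add_zero])
  have hd : 0 < d := neg_lt_zero.1 (show -d < 0 from hd0)
  refine ⟨ofBot d, ?_, fun f (hf : 0 < f) => ?_⟩
  · change 0 < ofBot d
    rw [← ofBot_zero, ← not_le, ofBot_le_ofBot_iff, not_le]
    exact hd
  · rcases inLevel_bot_or_exists_last f with hb | ⟨γ, hγ, hne⟩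
    · rw [eq_ofBot_of_inLevel hb] at hf ⊢
      rw [← ofBot_zero, ← not_le, ofBot_le_ofBot_iff, not_le] at hf
      rw [ofBot_le_ofBot_iff, ← neg_le_neg_iff]
      have hneg : (-f.1).val < 0 := neg_lt_zero.2 hf
      exact (nonneg_or (-f.1).val).resolve_left hneg.not_ge
    · have hdb : Below γ (ofBot d) := (inLevel_ofBot ⊥ d).below (bot_lt_level γ)
      refine under_zero_of_psi_neg (hdb.sub hγ) ?_
      have hpsi : psi γ (ofBot d) = 0 := by
        rw [psi_apply, phi_ofBot]
        have : trans ⊥ (level γ) d = 0 := by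
          apply Grp.ext
          rw [trans_val bot_le, zero_val]
          have h1 := neg_width_add_of_widthIdem_lt (x := (0 : M)) (i := level γ)
            (by rw [widthIdem_zero]; exact bot_lt_level γ)
          rw [width_zero] at h1
          calc d.val + (level γ).val = (-0 + d.val) + (level γ).val := by
                rw [add_comm (-0), add_assoc, h1]
            _ = (level γ).val := by rw [hinv, zero_add]
        rw [this]
        rfl
      rw [map_sub, hpsi, zero_sub, neg_lt_zero]
      exact psi_pos_of_pos hf hγ hne

/-- `δ` is the least nonzero idempotent. Opposites of generators lifting the zero of its subgroup
are negative, and with growing `n` they come closer to `0` than any given negative element. -/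
theorem denselyOrdered (h : (-0 : M) + -0 = -0) (h0 : (-0 : M) ≠ 0) :
    DenselyOrdered (Lift M) := by
  let e : Idem M := ⟨-0, h⟩
  have he : e ≠ ⊥ := fun h' => h0 (congrArg Idem.val h')
  have hneg : ∀ n, negGen he n 0 < 0 := fun n => by
    refine lt_of_le_of_ne (nonpos_iff.2 ?_) fun h' => ?_
    · have := under_negGen_cls (x := 0) he n (by rw [widthIdem_zero]; exact he.bot_lt)
      rwa [cls_zero] at this
    · have := congrArg (fun f : Lift M => f.2 (ofElement he n (-0))) h'
      simp only [negGen_snd, Finsupp.single_eq_same, zero_snd, Finsupp.zero_apply] at this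
      omega
  have key : ∀ f : Lift M, 0 < f → ∃ n, 0 < f + negGen he n 0 := by
    intro f hf
    rcases inLevel_bot_or_exists_last f with hb | ⟨γ, hγ, hne⟩
    · refine ⟨0, ?_⟩
      have hfb : Below (ofElement he 0 (-0)) f := hb.below (bot_lt_level _)
      refine pos_of_psi_pos (hfb.add (below_negGen he 0 0)) ?_
      refine Prod.Lex.toLex_lt_toLex.2 (Or.inl ?_)
      change 0 < phi e (f + negGen he 0 0)
      rw [map_add, phi_negGen, add_zero]
      rw [eq_ofBot_of_inLevel hb] at hf ⊢
      rw [← ofBot_zero, ← not_le, ofBot_le_ofBot_iff, not_le] at hf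
      -- A positive unit keeps a positive class at level `δ`: by residuation, `a + δ ≤ δ` means `a ≤
      -- 0`.
      rw [phi_ofBot, Grp.lt_def, trans_val bot_le, zero_val, ← not_le]
      change ¬ f.1.val + -0 ≤ -0
      rw [← le_neg_iff, neg_neg, not_le]
      exact hf
    · have hle : e ≤ level γ := by
        have h1 := neg_width_add_of_widthIdem_lt (x := (0 : M)) (i := level γ)
          (by rw [widthIdem_zero]; exact bot_lt_level γ)
        rwa [width_zero] at h1
      obtain ⟨n, hn⟩ := exists_ofElement_lt γ he hle
      have hb : Below γ (negGen he n 0) := (below_negGen he n 0).mono (hn _).le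
      refine ⟨n, pos_of_psi_pos (hγ.add hb) ?_⟩
      have : psi γ (negGen he n 0) = 0 := by
        rw [psi_apply, phi_trans (inLevel_negGen he n 0) hle, phi_negGen, map_zero, negGen_snd,
          Finsupp.single_eq_of_ne (hn _).ne']
        rfl
      rw [map_add, this, add_zero]
      exact psi_pos_of_pos hf hγ hne
  refine ⟨fun f g hfg => ?_⟩
  obtain ⟨n, hn⟩ := key (g - f) (sub_pos.2 hfg)
  refine ⟨f - negGen he n 0, ?_, ?_⟩
  · rw [lt_sub_iff_add_lt]
    simpa using hneg n
  · rw [← sub_pos]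
    convert hn using 1
    abel

end Lift

/-! ### Embedding doms of the first type -/

section FirstType

open Lift Classical in
/-- The embedding of a dom in `Tilde G`, where `G` is the lifting group: the invertible elements
are mapped to `G`, and the others to cuts. It has the desired properties if `-0 = 0`. -/
noncomputable def toTilde (x : M) : Tilde (Lift M) :=
  if h : ∃ a : Grp (⊥ : Idem M), a.val = x then Tilde.elt (ofBot h.choose) else Tilde.cut (cutAt x)

open Lift

variable {x y : M}

theorem toTilde_val (a : Grp (⊥ : Idem M)) : toTilde a.val = Tilde.elt (ofBot a) := by
  have h : ∃ b : Grp (⊥ : Idem M), b.val = a.val := ⟨a, rfl⟩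
  rw [toTilde, dif_pos h, Grp.ext h.choose_spec]

theorem toTilde_of_width_ne (h : width x ≠ 0) : toTilde x = Tilde.cut (cutAt x) := by
  refine dif_neg ?_
  rintro ⟨a, rfl⟩
  exact h (by rw [width_val, Idem.bot_val, width_zero])

/-- For `δ = 0`, width zero means `x + -x = 0`, so the opposite is the inverse. -/
theorem exists_val_eq (h0 : (-0 : M) = 0) (hx : width x = 0) :
    ∃ a : Grp (⊥ : Idem M), a.val = x ∧ a.inv = -x :=
  ⟨⟨x, -x, add_zero x, add_zero _, by rw [add_neg_eq, hx, h0]; rfl⟩, rfl, rfl⟩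

theorem width_add_ne_zero (h : width y ≠ 0) : width (x + y) ≠ 0 := fun h' =>
  h (le_antisymm (h' ▸ le_width_add) (width_nonneg y))

theorem toTilde_add (h0 : (-0 : M) = 0) (x y : M) : toTilde (x + y) = toTilde x + toTilde y := by
  by_cases hx : width x = 0 <;> by_cases hy : width y = 0
  · obtain ⟨a, rfl, -⟩ := exists_val_eq h0 hx
    obtain ⟨b, rfl, -⟩ := exists_val_eq h0 hy
    rw [← Grp.add_val, toTilde_val, toTilde_val, toTilde_val, Tilde.elt_add_elt, ofBot_add]
  · obtain ⟨a, rfl, -⟩ := exists_val_eq h0 hx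
    rw [toTilde_val, toTilde_of_width_ne hy, toTilde_of_width_ne (width_add_ne_zero hy),
      Tilde.elt_add_cut, translate_cutAt]
  · obtain ⟨b, rfl, -⟩ := exists_val_eq h0 hy
    rw [add_comm x, toTilde_val, toTilde_of_width_ne hx,
      toTilde_of_width_ne (width_add_ne_zero hx), Tilde.cut_add_elt, translate_cutAt]
  · rw [toTilde_of_width_ne hx, toTilde_of_width_ne hy,
      toTilde_of_width_ne (width_add_ne_zero hy), Tilde.cut_add_cut, cutAt_add]

theorem toTilde_neg (h0 : (-0 : M) = 0) (x : M) : toTilde (-x) = -toTilde x := by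
  by_cases hx : width x = 0
  · obtain ⟨a, rfl, ha⟩ := exists_val_eq h0 hx
    rw [← ha, ← Grp.neg_val, toTilde_val, toTilde_val, Tilde.neg_elt, ofBot_neg]
  · rw [toTilde_of_width_ne hx, toTilde_of_width_ne (by rwa [width_neg]), Tilde.neg_cut,
      cutAt_neg (Or.inl hx)]

theorem toTilde_le_iff (h0 : (-0 : M) = 0) : toTilde x ≤ toTilde y ↔ x ≤ y := by
  by_cases hx : width x = 0 <;> by_cases hy : width y = 0
  · obtain ⟨a, rfl, -⟩ := exists_val_eq h0 hx
    obtain ⟨b, rfl, -⟩ := exists_val_eq h0 hy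
    rw [toTilde_val, toTilde_val, Tilde.elt_le_elt, ofBot_le_ofBot_iff, Grp.le_def]
  · obtain ⟨a, rfl, -⟩ := exists_val_eq h0 hx
    rw [toTilde_val, toTilde_of_width_ne hy, Tilde.elt_le_cut, mem_cutAt, under_ofBot_iff]
  · obtain ⟨b, rfl, -⟩ := exists_val_eq h0 hy
    rw [toTilde_val, toTilde_of_width_ne hx, Tilde.cut_le_elt, mem_cutAt, under_ofBot_iff, not_le]
    exact ⟨le_of_lt, fun h => lt_of_le_of_ne h fun he => hx (he ▸ hy)⟩
  · rw [toTilde_of_width_ne hx, toTilde_of_width_ne hy, ← cutAt_le_cutAt_iff (Or.inl hy)]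
    rfl

end FirstType

end Dom

/-- A dom is an instance of the class `Dom`. -/
noncomputable abbrev IsDom.toDom {M : Type u} [LE M] [Zero M] [Add M] [Neg M] (h : IsDom M) :
    Dom M where
  add_assoc := h.add_assoc
  add_comm := h.add_comm
  zero_add x := (h.add_comm 0 x).trans (h.add_zero x)
  add_zero := h.add_zero
  nsmul := @nsmulRec M _ _
  le_refl := h.le_refl
  le_trans := h.le_trans
  le_antisymm := h.le_antisymm
  le_total := h.le_total
  toDecidableLE := Classical.decRel _
  add_le_add_left _ _ hab c := h.add_le_add_right _ _ c hab
  neg_neg := h.neg_neg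
  neg_zero_le' := h.delta_le
  nonneg_or' x := (h.abs_nonneg x).imp_right fun hx => by
    have := h.neg_le_neg _ _ hx
    rwa [h.neg_neg] at this
  le_neg_iff' a b := by
    rw [h.le_iff (-b) a, rsub, radd, h.neg_neg]
    constructor
    · intro hab
      have := h.neg_le_neg _ _ hab
      rw [h.neg_neg, h.neg_neg, h.add_comm] at this
      exact this
    · intro hab
      have := h.neg_le_neg _ _ hab
      rw [h.neg_neg] at this
      rwa [h.neg_neg, h.add_comm]

theorem nonempty_embedding {M N : Type*} [LE M] [Zero M] [Add M] [Neg M] [LE N] [Zero N] [Add N]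
    [Neg N] (hM : IsDom M) (hN : ∀ x : N, x ≤ x) (f : M → N) (hle : ∀ x y, f x ≤ f y ↔ x ≤ y)
    (h0 : f 0 = 0) (hadd : ∀ x y, f (x + y) = f x + f y) (hneg : ∀ x, f (-x) = -f x) :
    Nonempty (M ↪[domLang] N) :=
  ⟨{ toFun := f
     inj' := fun x y h => hM.le_antisymm _ _ ((hle x y).1 (h ▸ hN _)) ((hle y x).1 (h ▸ hN _))
     map_fun' := by
      intro n F x
      cases F
      · exact h0
      · exact hadd (x 0) (x 1)
      · exact hneg (x 0)
     map_rel' := by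
      intro n R x
      cases R
      exact hle (x 0) (x 1) }⟩

/-! ### Embeddings by type and the universal parts -/

variable {M : Type u} [LE M] [Zero M] [Add M] [Neg M]

theorem exists_embedding_tilde (hM : IsDom M) (h1 : FirstType M) :
    ∃ (G : Type u) (_ : AddCommGroup G) (_ : LinearOrder G) (_ : IsOrderedAddMonoid G),
      Nonempty (M ↪[domLang] Tilde G) := by
  let _ := hM.toDom
  exact ⟨Dom.Lift M, inferInstance, inferInstance, inferInstance,
    nonempty_embedding hM (Tilde.isDom _).le_refl Dom.toTilde
      (fun _ _ => Dom.toTilde_le_iff h1) (Dom.toTilde_val (0 : Dom.Grp (⊥ : Dom.Idem M)))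
      (Dom.toTilde_add h1) (Dom.toTilde_neg h1)⟩

theorem exists_embedding_cut_of_discrete (hM : IsDom M) (h2 : SecondType M) :
    ∃ (G : Type u) (_ : AddCommGroup G) (_ : LinearOrder G) (_ : IsOrderedAddMonoid G),
      DiscretelyOrdered G ∧ Nonempty (M ↪[domLang] Cut G) := by
  let _ := hM.toDom
  have h : (-0 : M) + -0 ≠ -0 := fun h => h2.2 h.ge
  have h0 : (-0 : M) ≠ 0 := fun h0 => h (by rw [h0, add_zero])
  exact ⟨Dom.Lift M, inferInstance, inferInstance, inferInstance, Dom.Lift.discretelyOrdered h,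
    nonempty_embedding hM (Cut.isDom _).le_refl Dom.Lift.cutAt
      (fun _ _ => Dom.Lift.cutAt_le_cutAt_iff (Or.inr h0)) Dom.Lift.cutAt_zero
      Dom.Lift.cutAt_add (fun _ => Dom.Lift.cutAt_neg (Or.inr h0))⟩

theorem exists_embedding_cut_of_dense (hM : IsDom M) (h3 : ThirdType M) :
    ∃ (G : Type u) (_ : AddCommGroup G) (_ : LinearOrder G) (_ : IsOrderedAddMonoid G),
      DenselyOrdered G ∧ Nonempty (M ↪[domLang] Cut G) := by
  let _ := hM.toDom
  have h0 : (-0 : M) ≠ 0 := fun h0 => h3.2.2 h0.ge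
  exact ⟨Dom.Lift M, inferInstance, inferInstance, inferInstance,
    Dom.Lift.denselyOrdered h3.1 h0,
    nonempty_embedding hM (Cut.isDom _).le_refl Dom.Lift.cutAt
      (fun _ _ => Dom.Lift.cutAt_le_cutAt_iff (Or.inr h0)) Dom.Lift.cutAt_zero
      Dom.Lift.cutAt_add (fun _ => Dom.Lift.cutAt_neg (Or.inr h0))⟩

theorem isUniversalPart_firstTheory : IsUniversalPart firstTheory tildeTheory.{u} := by
  refine isUniversalPart_of_universal_iff firstTheory_isUniversal fun φ hφ =>
    ⟨fun h G _ _ _ => ?_, fun h => models_of_forall_embedding.{u} hφ fun M _ _ _ _ hM => ?_⟩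
  · have : Tilde G ⊨ firstTheory := model_firstTheory.2 ⟨Tilde.isDom G, Tilde.firstType⟩
    have : Nonempty (Tilde G) := ⟨0⟩
    exact h.realize_sentence _
  · obtain ⟨h1, h2⟩ := model_firstTheory.1 hM
    obtain ⟨G, _, _, _, hG⟩ := exists_embedding_tilde h1 h2
    exact ⟨Tilde G, inferInstance, h G, hG⟩

theorem isUniversalPart_secondTheory : IsUniversalPart secondTheory discreteCutTheory.{u} := by
  refine isUniversalPart_of_universal_iff secondTheory_isUniversal fun φ hφ =>
    ⟨fun h G _ _ _ hG => ?_, fun h => models_of_forall_embedding.{u} hφ fun M _ _ _ _ hM => ?_⟩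
  · have : Cut G ⊨ secondTheory := model_secondTheory.2 ⟨Cut.isDom G, Cut.secondType hG⟩
    have : Nonempty (Cut G) := ⟨0⟩
    exact h.realize_sentence _
  · obtain ⟨h1, h2⟩ := model_secondTheory.1 hM
    obtain ⟨G, _, _, _, hd, hG⟩ := exists_embedding_cut_of_discrete h1 h2
    exact ⟨Cut G, inferInstance, h G hd, hG⟩

theorem isUniversalPart_thirdTheory : IsUniversalPart thirdTheory denseCutTheory.{u} := by
  refine isUniversalPart_of_universal_iff thirdTheory_isUniversal fun φ hφ =>
    ⟨fun h G _ _ _ hG => ?_, fun h => models_of_forall_embedding.{u} hφ fun M _ _ _ _ hM => ?_⟩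
  · have : Cut G ⊨ thirdTheory := model_thirdTheory.2 ⟨Cut.isDom G, Cut.thirdType hG⟩
    have : Nonempty (Cut G) := ⟨0⟩
    exact h.realize_sentence _
  · obtain ⟨h1, h2⟩ := model_thirdTheory.1 hM
    obtain ⟨G, _, _, _, hd, hG⟩ := exists_embedding_cut_of_dense h1 h2
    exact ⟨Cut G, inferInstance, h G hd, hG⟩

end DomCut

theorem theorem2 :
    -- first type
    (DomCut.IsUniversalPart DomCut.firstTheory DomCut.tildeTheory.{u} ∧
      ∀ (M : Type u) [LE M] [Zero M] [Add M] [Neg M],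
        DomCut.IsDom M → DomCut.FirstType M →
        ∃ (G : Type u) (_ : AddCommGroup G) (_ : LinearOrder G) (_ : IsOrderedAddMonoid G),
          Nonempty (M ↪[DomCut.domLang] DomCut.Tilde G)) ∧
    -- second type
    (DomCut.IsUniversalPart DomCut.secondTheory DomCut.discreteCutTheory.{u} ∧
      ∀ (M : Type u) [LE M] [Zero M] [Add M] [Neg M],
        DomCut.IsDom M → DomCut.SecondType M →
        ∃ (G : Type u) (_ : AddCommGroup G) (_ : LinearOrder G) (_ : IsOrderedAddMonoid G),
          DomCut.DiscretelyOrdered G ∧ Nonempty (M ↪[DomCut.domLang] DomCut.Cut G)) ∧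
    -- third type
    (DomCut.IsUniversalPart DomCut.thirdTheory DomCut.denseCutTheory.{u} ∧
      ∀ (M : Type u) [LE M] [Zero M] [Add M] [Neg M],
        DomCut.IsDom M → DomCut.ThirdType M →
        ∃ (G : Type u) (_ : AddCommGroup G) (_ : LinearOrder G) (_ : IsOrderedAddMonoid G),
          DenselyOrdered G ∧ Nonempty (M ↪[DomCut.domLang] DomCut.Cut G)) := by
  exact ⟨⟨DomCut.isUniversalPart_firstTheory,
      fun _ _ _ _ _ hM h => DomCut.exists_embedding_tilde hM h⟩,
    ⟨DomCut.isUniversalPart_secondTheory,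
      fun _ _ _ _ _ hM h => DomCut.exists_embedding_cut_of_discrete hM h⟩,
    ⟨DomCut.isUniversalPart_thirdTheory,
      fun _ _ _ _ _ hM h => DomCut.exists_embedding_cut_of_dense hM h⟩⟩
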